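/- Let $0<\gamma<1$, $a<b$, $c<d$, $T>0$, $\Omega=(a,b)\times(c,d)$, and $\delta(s,t)=(s^2+t^2)^{\gamma/2}$. Let $u$ be the exact solution of $$\frac{\partial u}{\partial t}(x,y,t)+\int_\Omega\frac{u(x,y,t)-u(\bar x,\bar y,t)}{\delta(x-\bar x,y-\bar y)}\,d\bar x\,d\bar y=f(x,y,t),\qquad (x,y,t)\in\Omega\times(0,T],$$ with boundary values $u=g$ on $\partial\Omega\times(0,T]$ and initial values $u(\cdot,\cdot,0)=u_0$ in $\Omega$ (the time derivative at $t=T$ is one-sided). Assume that $u(\cdot,\cdot,t)\in C^6([a,b]\times[c,d])$ with all derivatives of order at most $6$ bounded uniformly in $t\in[0,T]$, and that $u(x,y,\cdot)\in C^3([0,T])$ with derivatives of order at most $3$ bounded uniformly in $(x,y)\in[a,b]\times[c,d]$. For integers $M_x,M_y\ge 1$ let $h_x=(b-a)/M_x$, $h_y=(d-c)/M_y$, $x_{i/2}=a+\tfrac i2h_x$ $(0\le i\le 2M_x)$, $y_{j/2}=c+\tfrac j2h_y$ $(0\le j\le 2M_y)$. Let $\phi_{l/2}$ $(0\le l\le 2M_x)$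 be the continuous functions on $[a,b]$ that are quadratic polynomials on each cell $[x_{m-1},x_m]$, $1\le m\le M_x$, with $\phi_{l/2}(x_{i/2})=1$ if $i=l$ and $0$ otherwise, and let $\phi_{r/2}(\bar y)$ $(0\le r\le 2M_y)$ be the analogous functions on $[c,d]$ for the mesh $y_{j/2}$. Put $$d_{i,j}=\int_\Omega\frac{d\bar x\,d\bar y}{\delta(x_{i/2}-\bar x,y_{j/2}-\bar y)},\qquad g_{i,j}^{l,r}=\int_\Omega\frac{\phi_{l/2}(\bar x)\,\phi_{r/2}(\bar y)}{\delta(x_{i/2}-\bar x,y_{j/2}-\bar y)}\,d\bar x\,d\bar y .$$ Let $\mathcal A=\mathcal D-\mathcal G$ be the matrix whose rows and columns are indexed by the pairs $(i,j)$ with $1\le i\le 2M_x-1$, $1\le j\le 2M_y-1$, where $\mathcal D=\mathrm{diag}(d_{i,j})$ and $\mathcal G=(g_{i,j}^{l,r})_{(i,j),(l,r)}$. For $\tau>0$ and an integer $N\ge 0$ with $N\tau\le T$, let $t_k=k\tau$ and consider the Crank–Nicolson scheme $$\Bigl(I+\frac\tau2\mathcal A\Bigr)U^k=\Bigl(I-\frac\tau2\mathcal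 A\Bigr)U^{k-1}+\tau F^{k-\frac12}+\tau K^{k-\frac12},\qquad k=1,\dots,N,$$ for vectors $U^k=(u^k_{i/2,j/2})$, with $u^0_{i/2,j/2}=u_0(x_{i/2},y_{j/2})$, where $F^{k-\frac12}$ has the entries $f(x_{i/2},y_{j/2},(k-\tfrac12)\tau)$ and $K^{k-\frac12}$ has the entries $$\sum_{(l,r)} g_{i,j}^{l,r}\,g\bigl(x_{l/2},y_{r/2},(k-\tfrac12)\tau\bigr),$$ the sum being over those $(l,r)$ with $0\le l\le 2M_x$, $0\le r\le 2M_y$ and $l\in\{0,2M_x\}$ or $r\in\{0,2M_y\}$. Let $C_d=\dfrac{2(b-a)(d-c)^{1-\gamma}}{1-\gamma}$ and $\tau_0=\dfrac1{10C_d}$. Then there is a constant $C$, independent of $M_x,M_y,N,\tau$, such that for all $M_x,M_y\ge1$, all $0<\tau<\tau_0$ and all $N$ with $N\tau\le T$ the scheme has exactly one solution, and this solution satisfies $$\bigl|u(x_{i/2},y_{j/2},t_k)-u^k_{i/2,j/2}\bigr|\le C\bigl(\tau^2+h_x^{4-\gamma}+h_y^{4-\gamma}\bigr)$$ for $1\le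 i\le 2M_x-1$, $1\le j\le 2M_y-1$, $0\le k\le N$. -/

import Mathlib

open MeasureTheory Set

namespace Nonlocal2D

noncomputable section

/-- The open rectangle `Ω = (a, b) × (c, d)`. -/
def Omega (a b c d : ℝ) : Set (ℝ × ℝ) := Ioo a b ×ˢ Ioo c d

/-- The function `δ(s, t) = |√(s² + t²)| ^ γ`; the additive Cauchy kernel is its reciprocal. -/
def delta (γ s t : ℝ) : ℝ := |Real.sqrt (s ^ 2 + t ^ 2)| ^ γ

/-- `u` is a solution on `Ω × (0, T]` of
`∂u/∂t (x,y,t) + ∫_Ω (u(x,y,t) - u(x',y',t)) / δ(x - x', y - y') dx' dy' = f(x,y,t)`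
with Dirichlet boundary values `g` on `∂Ω` and initial value `u₀`.
The time derivative is taken within `[0, T]`, so that it is one-sided at `t = T`. -/
structure IsExactSolution (γ a b c d T : ℝ) (f g : ℝ → ℝ → ℝ → ℝ) (u₀ : ℝ → ℝ → ℝ)
    (u : ℝ → ℝ → ℝ → ℝ) : Prop where
  equation : ∀ x y t, (x, y) ∈ Omega a b c d → t ∈ Ioc 0 T →
    HasDerivWithinAt (fun s => u x y s)
      (f x y t - ∫ q in Omega a b c d, (u x y t - u q.1 q.2 t) / delta γ (x - q.1) (y - q.2))
      (Icc 0 T) t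
  boundary : ∀ x y t, (x, y) ∈ frontier (Omega a b c d) → t ∈ Ioc 0 T → u x y t = g x y t
  initial : ∀ x y, (x, y) ∈ Omega a b c d → u x y 0 = u₀ x y

/-- Smoothness of a function on `[a, b] × [c, d] × [0, T]`: of class `C⁶` in space with
derivatives bounded uniformly in time, and of class `C³` in time with derivatives bounded
uniformly in space. Every function that is jointly of class `C⁶` qualifies. -/
structure IsSmooth (a b c d T : ℝ) (u : ℝ → ℝ → ℝ → ℝ) : Prop where
  space : ∀ t ∈ Icc 0 T,
    ContDiffOn ℝ 6 (fun p : ℝ × ℝ => u p.1 p.2 t) (Icc a b ×ˢ Icc c d)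
  space_bound : ∃ B : ℝ, ∀ t ∈ Icc 0 T, ∀ p ∈ Icc a b ×ˢ Icc c d, ∀ m : ℕ, m ≤ 6 →
    ‖iteratedFDerivWithin ℝ m (fun p : ℝ × ℝ => u p.1 p.2 t) (Icc a b ×ˢ Icc c d) p‖ ≤ B
  time : ∀ x ∈ Icc a b, ∀ y ∈ Icc c d, ContDiffOn ℝ 3 (fun t => u x y t) (Icc 0 T)
  time_bound : ∃ B : ℝ, ∀ x ∈ Icc a b, ∀ y ∈ Icc c d, ∀ t ∈ Icc 0 T, ∀ m : ℕ, m ≤ 3 →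
    |iteratedDerivWithin m (fun t => u x y t) (Icc 0 T) t| ≤ B

/-- The uniform mesh size `(b - a) / M`. -/
def meshSize (a b : ℝ) (M : ℕ) : ℝ := (b - a) / M

/-- The mesh point `x_{i/2} = a + (i/2) h`, for `0 ≤ i ≤ 2M`. -/
def node (a b : ℝ) (M i : ℕ) : ℝ := a + (i / 2 : ℝ) * meshSize a b M

/-- The piecewise quadratic Lagrange basis function `φ_{i/2}` on `[a, b]`, for `0 ≤ i ≤ 2M`.
For even `i` it belongs to an end point of the cells of length `h`, for odd `i` to the midpoint of
a cell. For `i = 0` and `i = 2M` one of the two branches lies outside `(a, b)`; the basis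
functions are only ever integrated over `(a, b)`. -/
def basisFun (a b : ℝ) (M i : ℕ) (x : ℝ) : ℝ :=
  let h := meshSize a b M
  let z := node a b M i
  if Even i then
    if x ∈ Icc (z - h) z then (x - (z - h)) / h * ((2 * x - (z + (z - h))) / h)
    else if x ∈ Icc z (z + h) then ((z + h) - x) / h * ((((z + h) + z) - 2 * x) / h)
    else 0
  else
    if x ∈ Icc (z - h / 2) (z + h / 2) then
      4 * (x - (z - h / 2)) * ((z + h / 2) - x) / h ^ 2
    else 0

/-- The diagonal coefficient `∫_Ω 1 / δ(x_{i/2} - x', y_{j/2} - y') dx' dy'`. -/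
def diagCoeff (γ a b c d : ℝ) (Mx My i j : ℕ) : ℝ :=
  ∫ q in Omega a b c d, 1 / delta γ (node a b Mx i - q.1) (node c d My j - q.2)

/-- The coefficient
`∫_Ω φ_{l/2}(x') φ_{r/2}(y') / δ(x_{i/2} - x', y_{j/2} - y') dx' dy'`. -/
def basisCoeff (γ a b c d : ℝ) (Mx My i j l r : ℕ) : ℝ :=
  ∫ q in Omega a b c d, basisFun a b Mx l q.1 * basisFun c d My r q.2 /
    delta γ (node a b Mx i - q.1) (node c d My j - q.2)

/-- Indices of the interior collocation points: `(i, j)` stands for the point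
`(x_{(i+1)/2}, y_{(j+1)/2})`, where `1 ≤ i + 1 ≤ 2 Mx - 1` and `1 ≤ j + 1 ≤ 2 My - 1`. -/
abbrev Index (Mx My : ℕ) : Type := Fin (2 * Mx - 1) × Fin (2 * My - 1)

/-- The values of a function at the interior collocation points. -/
def gridFun (a b c d : ℝ) (Mx My : ℕ) (v : ℝ → ℝ → ℝ) : Index Mx My → ℝ :=
  fun p => v (node a b Mx (p.1 + 1)) (node c d My (p.2 + 1))

/-- The diagonal matrix `D`. -/
def matD (γ a b c d : ℝ) (Mx My : ℕ) : Matrix (Index Mx My) (Index Mx My) ℝ :=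
  Matrix.diagonal fun p => diagCoeff γ a b c d Mx My (p.1 + 1) (p.2 + 1)

/-- The full matrix `G`. -/
def matG (γ a b c d : ℝ) (Mx My : ℕ) : Matrix (Index Mx My) (Index Mx My) ℝ :=
  Matrix.of fun p q =>
    basisCoeff γ a b c d Mx My (p.1 + 1) (p.2 + 1) (q.1 + 1) (q.2 + 1)

/-- The stiffness matrix `A = D - G`. -/
def matA (γ a b c d : ℝ) (Mx My : ℕ) : Matrix (Index Mx My) (Index Mx My) ℝ :=
  matD γ a b c d Mx My - matG γ a b c d Mx My

/-- The boundary vector `K` that belongs to the boundary values `w`: the contribution of the mesh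
points on `∂Ω` to the integral of the piecewise quadratic interpolant. -/
def boundaryVec (γ a b c d : ℝ) (Mx My : ℕ) (w : ℝ → ℝ → ℝ) : Index Mx My → ℝ :=
  fun p =>
    let G := basisCoeff γ a b c d Mx My (p.1 + 1) (p.2 + 1)
    (∑ r ∈ Finset.Icc 0 (2 * My), G 0 r * w (node a b Mx 0) (node c d My r))
    + (∑ r ∈ Finset.Icc 0 (2 * My), G (2 * Mx) r * w (node a b Mx (2 * Mx)) (node c d My r))
    + (∑ l ∈ Finset.Icc 1 (2 * Mx - 1), G l 0 * w (node a b Mx l) (node c d My 0))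
    + (∑ l ∈ Finset.Icc 1 (2 * Mx - 1),
        G l (2 * My) * w (node a b Mx l) (node c d My (2 * My)))

/-- `U⁰, …, U^N` is a solution of the Crank-Nicolson collocation scheme
`(I + τ/2 A) U^k = (I - τ/2 A) U^{k-1} + τ F^{k-1/2} + τ K^{k-1/2}`, `k = 1, …, N`,
with data `f` and `g` taken at `t_{k-1/2} = (k - 1/2) τ`, started from the exact initial values.
(Below `k` runs over `0, …, N - 1` and stands for `k - 1`.) -/
structure IsSchemeSolution (γ a b c d : ℝ) (f g : ℝ → ℝ → ℝ → ℝ) (u₀ : ℝ → ℝ → ℝ)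
    (Mx My N : ℕ) (τ : ℝ) (U : Fin (N + 1) → Index Mx My → ℝ) : Prop where
  start : U 0 = gridFun a b c d Mx My u₀
  step : ∀ k : Fin N,
    (1 + (τ / 2) • matA γ a b c d Mx My).mulVec (U k.succ) =
      (1 - (τ / 2) • matA γ a b c d Mx My).mulVec (U k.castSucc)
      + τ • gridFun a b c d Mx My (fun x y => f x y (((k : ℝ) + 1 / 2) * τ))
      + τ • boundaryVec γ a b c d Mx My (fun x y => g x y (((k : ℝ) + 1 / 2) * τ))

/-- The constant `C_d = 2 (b - a) (d - c)^{1-γ} / (1 - γ)`. -/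
def constCd (γ a b c d : ℝ) : ℝ := 2 * (b - a) * (d - c) ^ (1 - γ) / (1 - γ)

end

end Nonlocal2D

/-!
Every basis function of the piecewise quadratic interpolation is bounded, so `A` is bounded in the
maximum norm by `10 * C_d`, uniformly in the mesh. Hence `I + τ/2 A` is invertible for
`τ * (10 * C_d) ≤ 1`, and a discrete Gronwall argument reduces convergence to consistency.

In time, the scheme is a midpoint rule and has truncation error `O(τ²)`. In space, `A v - K` differs
from the nonlocal operator by the potential of the interpolation error of `v`, taken one variable
at a time. Pointwise this error is only `O(h³)`, but its leading term is odd about the centre of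
each cell, so that its primitive is `O(h⁴)` at the mesh points. Away from the singularity, an
integration by parts moves a derivative onto the kernel and gains the factor `h`; the neighbourhood
of width `h` of the singularity contributes `h³ * h ^ (1 - γ)`. Both parts are `O(h ^ (4 - γ))`.
-/

namespace Nonlocal2D

open scoped Nat

/-! ### Taylor expansion on an interval -/

/-- `f` is of class `Cⁿ` on `s` and its derivatives of order at most `n` within `s` are bounded
by `B`: the regularity of a one-dimensional slice of the exact solution. -/
structure HasBoundedDerivs (n : ℕ) (B : ℝ) (f : ℝ → ℝ) (s : Set ℝ) : Prop where
  contDiffOn : ContDiffOn ℝ n f s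
  abs_iteratedDerivWithin_le : ∀ m ≤ n, ∀ x ∈ s, |iteratedDerivWithin m f s x| ≤ B

namespace HasBoundedDerivs

variable {a b p x τ t B : ℝ} {n : ℕ} {f : ℝ → ℝ}

theorem abs_self_le {S : Set ℝ} (hf : HasBoundedDerivs n B f S) (hx : x ∈ S) : |f x| ≤ B := by
  simpa using hf.abs_iteratedDerivWithin_le 0 n.zero_le x hx

theorem nonneg {S : Set ℝ} (hf : HasBoundedDerivs n B f S) (hx : x ∈ S) : 0 ≤ B :=
  (abs_nonneg _).trans (hf.abs_self_le hx)

theorem mono_order {m : ℕ} {S : Set ℝ} (hf : HasBoundedDerivs n B f S) (hmn : m ≤ n) :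
    HasBoundedDerivs m B f S :=
  ⟨hf.contDiffOn.of_le (by exact_mod_cast hmn),
    fun k hk => hf.abs_iteratedDerivWithin_le k (hk.trans hmn)⟩

protected theorem derivWithin {S : Set ℝ} (hf : HasBoundedDerivs (n + 1) B f S)
    (hS : UniqueDiffOn ℝ S) : HasBoundedDerivs n B (derivWithin f S) S where
  contDiffOn := hf.contDiffOn.derivWithin hS (by norm_cast)
  abs_iteratedDerivWithin_le m hm x hx := by
    rw [← iteratedDerivWithin_succ']
    exact hf.abs_iteratedDerivWithin_le (m + 1) (by omega) x hx

theorem abs_sub_taylor_le (hf : HasBoundedDerivs (n + 1) B f (Icc a b)) (hp : p ∈ Icc a b)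
    (hx : x ∈ Icc p b) :
    |f x - ∑ k ∈ Finset.range (n + 1), iteratedDerivWithin k f (Icc a b) p / k ! * (x - p) ^ k|
      ≤ B * (x - p) ^ (n + 1) / n ! := by
  rcases hx.1.eq_or_lt with rfl | hpx
  · simp [Finset.sum_range_succ']
  have hpb : p < b := hpx.trans_le hx.2
  have hsub : Icc p b ⊆ Icc a b := Icc_subset_Icc_left hp.1
  have hderiv (k : ℕ) (hk : k ≤ n + 1) (y : ℝ) (hy : y ∈ Icc p b) :
      iteratedDerivWithin k f (Icc p b) y = iteratedDerivWithin k f (Icc a b) y := by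
    unfold iteratedDerivWithin
    rw [iteratedFDerivWithin_subset hsub (uniqueDiffOn_Icc hpb)
      (uniqueDiffOn_Icc (hp.1.trans_lt hpb)) (hf.mono_order hk).contDiffOn hy]
  have htaylor := taylor_mean_remainder_bound hpb.le
    (by exact_mod_cast hf.contDiffOn.mono hsub) hx fun y hy => by
      rw [hderiv _ le_rfl y hy]
      exact hf.abs_iteratedDerivWithin_le _ le_rfl y (hsub hy)
  rw [Real.norm_eq_abs, taylor_within_apply] at htaylor
  convert htaylor using 4 with k hk
  rw [hderiv k (Finset.mem_range.1 hk).le p (left_mem_Icc.2 hpb.le), smul_eq_mul]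
  ring

theorem abs_average_sub_midpoint_le (hf : HasBoundedDerivs 2 B f (Icc a b)) (hτ : 0 ≤ τ)
    (ht : t ∈ Icc a b) (htτ : t + τ ≤ b) :
    |(f t + f (t + τ)) / 2 - f (t + τ / 2)| ≤ B * τ ^ 2 := by
  have hB := hf.nonneg ht
  have hend := hf.abs_sub_taylor_le ht ⟨le_add_of_nonneg_right hτ, htτ⟩
  have hmid := hf.abs_sub_taylor_le (x := t + τ / 2) ht ⟨by linarith, by linarith⟩
  simp only [add_sub_cancel_left, Finset.sum_range_succ, Finset.sum_range_zero, Nat.factorial,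
    iteratedDerivWithin_zero, Nat.cast_one, pow_zero, pow_one, Nat.reduceAdd, mul_one, div_one,
    zero_add] at hend hmid
  have hBτ : 0 ≤ B * τ ^ 2 := by positivity
  rw [abs_le] at hend hmid ⊢
  constructor <;> nlinarith

theorem abs_sub_sub_midpoint_derivWithin_le (hf : HasBoundedDerivs 3 B f (Icc a b)) (hτ : 0 < τ)
    (ht : t ∈ Icc a b) (htτ : t + τ ≤ b) :
    |f (t + τ) - f t - τ * derivWithin f (Icc a b) (t + τ / 2)| ≤ B * τ ^ 3 := by
  have hB := hf.nonneg ht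
  have hend := hf.abs_sub_taylor_le ht ⟨le_add_of_nonneg_right hτ.le, htτ⟩
  have hmid := (hf.derivWithin (uniqueDiffOn_Icc (by linarith [ht.1]))).abs_sub_taylor_le
    (x := t + τ / 2) ht ⟨by linarith, by linarith⟩
  simp only [add_sub_cancel_left, Finset.sum_range_succ, Finset.sum_range_zero, Nat.factorial,
    iteratedDerivWithin_zero, ← iteratedDerivWithin_succ', Nat.cast_one, pow_zero, pow_one,
    Nat.reduceAdd, mul_one, div_one, zero_add] at hend hmid
  have hmid' := mul_le_mul_of_nonneg_left hmid hτ.le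
  rw [← abs_of_pos hτ, ← abs_mul, abs_of_pos hτ] at hmid'
  have hBτ : 0 ≤ B * τ ^ 3 := by positivity
  rw [iteratedDerivWithin_one] at hend hmid'
  rw [abs_le] at hend hmid' ⊢
  constructor <;> nlinarith

end HasBoundedDerivs

/-! ### Piecewise quadratic interpolation -/

section Mesh

variable {a b : ℝ} {M : ℕ}

theorem meshSize_pos_iff : 0 < meshSize a b M ↔ a < b ∧ 0 < M := by
  rcases M.eq_zero_or_pos with rfl | hM
  · simp [meshSize]
  · rw [meshSize, div_pos_iff_of_pos_right (by exact_mod_cast hM), sub_pos, and_iff_left hM]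

theorem mul_meshSize (hM : 0 < M) : M * meshSize a b M = b - a :=
  mul_div_cancel₀ _ (by exact_mod_cast hM.ne')

theorem meshSize_le (hh : 0 < meshSize a b M) : meshSize a b M ≤ b - a :=
  have ⟨hab, hM⟩ := meshSize_pos_iff.1 hh
  div_le_self (sub_pos.2 hab).le (by exact_mod_cast hM)

theorem node_zero (a b : ℝ) (M : ℕ) : node a b M 0 = a := by simp [node]

theorem node_add (a b : ℝ) (M i j : ℕ) :
    node a b M (i + j) = node a b M i + j / 2 * meshSize a b M := by
  simp only [node, Nat.cast_add]
  ring

theorem node_add_one (a b : ℝ) (M i : ℕ) :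
    node a b M (i + 1) = node a b M i + meshSize a b M / 2 := by
  rw [node_add, Nat.cast_one]
  ring

theorem node_add_two (a b : ℝ) (M i : ℕ) :
    node a b M (i + 2) = node a b M i + meshSize a b M := by
  rw [node_add, Nat.cast_two, div_self two_ne_zero, one_mul]

theorem node_two_mul (hM : 0 < M) : node a b M (2 * M) = b := by
  rw [node, Nat.cast_mul, Nat.cast_two, mul_div_cancel_left₀ _ two_ne_zero, mul_meshSize hM]
  ring

theorem node_strictMono (hh : 0 < meshSize a b M) : StrictMono (node a b M) :=
  strictMono_nat_of_lt_succ fun i => by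
    rw [node_add_one]
    linarith

theorem node_mem_Icc {i : ℕ} (hh : 0 < meshSize a b M) (hi : i ≤ 2 * M) :
    node a b M i ∈ Icc a b :=
  have hmono := (node_strictMono hh).monotone
  ⟨(node_zero a b M).ge.trans (hmono i.zero_le),
    (hmono hi).trans (node_two_mul (meshSize_pos_iff.1 hh).2).le⟩

theorem node_mem_Ioo {i : ℕ} (hh : 0 < meshSize a b M) (hi₀ : 0 < i) (hi : i < 2 * M) :
    node a b M i ∈ Ioo a b :=
  ⟨(node_zero a b M).ge.trans_lt (node_strictMono hh hi₀),
    (node_strictMono hh hi).trans_le (node_two_mul (meshSize_pos_iff.1 hh).2).le⟩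

theorem exists_mem_cell {x : ℝ} (hh : 0 < meshSize a b M) (hx : x ∈ Icc a b) :
    ∃ m < M, x ∈ Icc (node a b M (2 * m)) (node a b M (2 * m + 2)) := by
  have hM := (meshSize_pos_iff.1 hh).2
  rcases hx.2.eq_or_lt with rfl | hxb
  · refine ⟨M - 1, by omega, ?_⟩
    rw [show 2 * (M - 1) + 2 = 2 * M by omega, node_two_mul hM]
    exact ⟨(node_mem_Icc hh (by omega)).2, le_rfl⟩
  have hxa : 0 ≤ (x - a) / meshSize a b M := div_nonneg (sub_nonneg.2 hx.1) hh.le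
  have hlower := Nat.floor_le hxa
  have hupper := Nat.lt_floor_add_one ((x - a) / meshSize a b M)
  rw [le_div_iff₀ hh] at hlower
  rw [div_lt_iff₀ hh] at hupper
  refine ⟨⌊(x - a) / meshSize a b M⌋₊, ?_, ?_, ?_⟩
  · rw [Nat.floor_lt hxa, div_lt_iff₀ hh, mul_meshSize hM]
    linarith
  · simp only [node, Nat.cast_mul, Nat.cast_two]
    linarith
  · rw [node_add_two, node, Nat.cast_mul, Nat.cast_two]
    linarith

end Mesh

section Basis

variable {a b x : ℝ} {M i : ℕ}

theorem basisFun_of_even (hh : 0 < meshSize a b M) (hi : Even i) (x : ℝ) :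
    basisFun a b M i x = max 0 (1 - |x - node a b M i| / meshSize a b M) *
      (1 - 2 * (|x - node a b M i| / meshSize a b M)) := by
  simp only [basisFun, if_pos hi, mem_Icc]
  set h := meshSize a b M
  set z := node a b M i
  split_ifs with hleft hright
  · have hdist : |x - z| = z - x := abs_sub_comm x z ▸ abs_of_nonneg (sub_nonneg.2 hleft.2)
    have hle : (z - x) / h ≤ 1 := (div_le_one hh).2 (by linarith)
    rw [hdist, max_eq_right (by linarith)]
    field_simp
    ring
  · have hdist : |x - z| = x - z := abs_of_nonneg (sub_nonneg.2 hright.1)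
    have hle : (x - z) / h ≤ 1 := (div_le_one hh).2 (by linarith)
    rw [hdist, max_eq_right (by linarith)]
    field_simp
    ring
  · have hfar : h ≤ |x - z| := by
      by_contra! hnear
      rw [abs_lt] at hnear
      rcases le_total x z with hxz | hzx
      · exact hleft ⟨by linarith, hxz⟩
      · exact hright ⟨hzx, by linarith⟩
    rw [max_eq_left (sub_nonpos.2 ((one_le_div hh).2 hfar)), zero_mul]

theorem basisFun_of_odd (hh : 0 < meshSize a b M) (hi : ¬Even i) (x : ℝ) :
    basisFun a b M i x = max 0 (1 - (2 * |x - node a b M i| / meshSize a b M) ^ 2) := by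
  simp only [basisFun, if_neg hi, mem_Icc]
  set h := meshSize a b M
  set z := node a b M i
  have hfactor : 4 * (x - (z - h / 2)) * ((z + h / 2) - x) / h ^ 2
      = 1 - (2 * |x - z| / h) ^ 2 := by
    rw [div_pow, mul_pow, sq_abs]
    field_simp
    ring
  have hsupport : (z - h / 2 ≤ x ∧ x ≤ z + h / 2) ↔ 2 * |x - z| / h ≤ 1 := by
    rw [div_le_one hh, ← le_div_iff₀' two_pos, abs_le]
    constructor <;> rintro ⟨h₁, h₂⟩ <;> constructor <;> linarith
  have hdist : 0 ≤ 2 * |x - z| / h := by positivity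
  simp only [hfactor, hsupport]
  split_ifs with hx
  · exact (max_eq_right (sub_nonneg.2 (pow_le_one₀ hdist hx))).symm
  · exact (max_eq_left (sub_nonpos.2 (one_le_pow₀ (not_le.1 hx).le))).symm

theorem continuous_basisFun (hh : 0 < meshSize a b M) (i : ℕ) :
    Continuous (basisFun a b M i) := by
  by_cases hi : Even i
  · rw [funext (basisFun_of_even hh hi)]
    fun_prop
  · rw [funext (basisFun_of_odd hh hi)]
    fun_prop

theorem abs_basisFun_le_one (hh : 0 < meshSize a b M) (i : ℕ) (x : ℝ) :
    |basisFun a b M i x| ≤ 1 := by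
  by_cases hi : Even i
  · rw [basisFun_of_even hh hi]
    have hs : 0 ≤ |x - node a b M i| / meshSize a b M := by positivity
    generalize |x - node a b M i| / meshSize a b M = s at hs
    rcases le_total (1 - s) 0 with h | h
    · simp [max_eq_left h]
    · rw [max_eq_right h, abs_le]
      constructor <;> nlinarith [sq_nonneg (4 * s - 3)]
  · rw [basisFun_of_odd hh hi, abs_of_nonneg (le_max_left _ _)]
    exact max_le zero_le_one (sub_le_self _ (sq_nonneg _))

theorem basisFun_eq_zero_of_even (hh : 0 < meshSize a b M) (hi : Even i)
    (hx : meshSize a b M ≤ |x - node a b M i|) : basisFun a b M i x = 0 := by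
  rw [basisFun_of_even hh hi, max_eq_left (sub_nonpos.2 ((one_le_div hh).2 hx)), zero_mul]

theorem basisFun_eq_zero_of_odd (hh : 0 < meshSize a b M) (hi : ¬Even i)
    (hx : meshSize a b M / 2 ≤ |x - node a b M i|) : basisFun a b M i x = 0 := by
  rw [basisFun_of_odd hh hi, max_eq_left]
  exact sub_nonpos.2 (one_le_pow₀ ((one_le_div hh).2 (by linarith)))

theorem basisFun_eq_zero_of_mem_cell {m : ℕ} (hh : 0 < meshSize a b M)
    (hx : x ∈ Icc (node a b M (2 * m)) (node a b M (2 * m + 2)))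
    (hi : i ∉ Finset.Icc (2 * m) (2 * m + 2)) : basisFun a b M i x = 0 := by
  have hmono := (node_strictMono hh).monotone
  simp only [Finset.mem_Icc, not_and_or, not_le] at hi
  by_cases heven : Even i
  · refine basisFun_eq_zero_of_even hh heven ?_
    obtain ⟨k, rfl⟩ := heven
    rcases hi with hleft | hright
    · have := node_add_two a b M (k + k) ▸ hmono (show k + k + 2 ≤ 2 * m by omega)
      exact le_abs.2 (.inl (by linarith [hx.1]))
    · have := node_add_two a b M (2 * m + 2) ▸ hmono (show 2 * m + 2 + 2 ≤ k + k by omega)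
      exact le_abs.2 (.inr (by linarith [hx.2]))
  · refine basisFun_eq_zero_of_odd hh heven ?_
    rcases hi with hleft | hright
    · have := node_add_one a b M i ▸ hmono (Nat.succ_le_of_lt hleft)
      exact le_abs.2 (.inl (by linarith [hx.1]))
    · have := node_add_one a b M (2 * m + 2) ▸ hmono (Nat.succ_le_of_lt hright)
      exact le_abs.2 (.inr (by linarith [hx.2]))

theorem sum_range_eq_of_cell {m : ℕ} (hm : m < M) {F : ℕ → ℝ}
    (hF : ∀ i ∉ Finset.Icc (2 * m) (2 * m + 2), F i = 0) :
    ∑ i ∈ Finset.range (2 * M + 1), F i = F (2 * m) + F (2 * m + 1) + F (2 * m + 2) := by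
  have hsub : Finset.Icc (2 * m) (2 * m + 2) ⊆ Finset.range (2 * M + 1) := fun i hi => by
    rw [Finset.mem_Icc] at hi
    rw [Finset.mem_range]
    omega
  rw [← Finset.sum_subset hsub fun i _ hi => hF i hi, ← Finset.Ico_add_one_right_eq_Icc,
    Finset.sum_Ico_eq_sum_range, show 2 * m + 2 + 1 - 2 * m = 3 by omega]
  simp only [Finset.sum_range_succ, Finset.sum_range_zero, zero_add, add_zero]

theorem sum_abs_basisFun_le (hh : 0 < meshSize a b M) (hx : x ∈ Icc a b) :
    ∑ i ∈ Finset.range (2 * M + 1), |basisFun a b M i x| ≤ 3 := by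
  obtain ⟨m, hm, hxm⟩ := exists_mem_cell hh hx
  rw [sum_range_eq_of_cell hm fun i hi => by
    rw [basisFun_eq_zero_of_mem_cell hh hxm hi, abs_zero]]
  have hle := abs_basisFun_le_one hh
  linarith [hle (2 * m) x, hle (2 * m + 1) x, hle (2 * m + 2) x]

end Basis

section Interp

variable {a b x K : ℝ} {M m : ℕ} {v w : ℝ → ℝ}

/-- The piecewise quadratic interpolant of `v` on the mesh with `M` cells. -/
noncomputable def interp (a b : ℝ) (M : ℕ) (v : ℝ → ℝ) (x : ℝ) : ℝ :=
  ∑ i ∈ Finset.range (2 * M + 1), basisFun a b M i x * v (node a b M i)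

/-- The error of piecewise quadratic interpolation. -/
noncomputable def interpErr (a b : ℝ) (M : ℕ) (v : ℝ → ℝ) (x : ℝ) : ℝ := v x - interp a b M v x

theorem continuous_interp (hh : 0 < meshSize a b M) (v : ℝ → ℝ) :
    Continuous (interp a b M v) :=
  continuous_finsetSum _ fun i _ => (continuous_basisFun hh i).mul_const _

theorem continuousOn_interpErr (hh : 0 < meshSize a b M) (hv : ContinuousOn v (Icc a b)) :
    ContinuousOn (interpErr a b M v) (Icc a b) :=
  hv.sub (continuous_interp hh v).continuousOn

theorem intervalIntegrable_interpErr (hh : 0 < meshSize a b M) (hv : ContinuousOn v (Icc a b))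
    {p q : ℝ} (hp : p ∈ Icc a b) (hq : q ∈ Icc a b) :
    IntervalIntegrable (interpErr a b M v) volume p q :=
  ((continuousOn_interpErr hh hv).mono (uIcc_subset_Icc hp hq)).intervalIntegrable

theorem interpErr_add (a b : ℝ) (M : ℕ) (v w : ℝ → ℝ) (x : ℝ) :
    interpErr a b M (fun y => v y + w y) x = interpErr a b M v x + interpErr a b M w x := by
  simp only [interpErr, interp, mul_add, Finset.sum_add_distrib]
  ring

theorem interp_of_mem_cell (hh : 0 < meshSize a b M) (hm : m < M)
    (hx : x ∈ Icc (node a b M (2 * m)) (node a b M (2 * m + 2))) :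
    interp a b M v x = basisFun a b M (2 * m) x * v (node a b M (2 * m))
      + basisFun a b M (2 * m + 1) x * v (node a b M (2 * m + 1))
      + basisFun a b M (2 * m + 2) x * v (node a b M (2 * m + 2)) :=
  sum_range_eq_of_cell hm fun i hi => by rw [basisFun_eq_zero_of_mem_cell hh hx hi, zero_mul]

theorem abs_interpErr_le_of_mem_cell (hh : 0 < meshSize a b M) (hm : m < M)
    (hx : x ∈ Icc (node a b M (2 * m)) (node a b M (2 * m + 2)))
    (hv : ∀ y ∈ Icc (node a b M (2 * m)) (node a b M (2 * m + 2)), |v y| ≤ K) :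
    |interpErr a b M v x| ≤ 4 * K := by
  have hmono := (node_strictMono hh).monotone
  have hterm (i : ℕ) (hi : 2 * m ≤ i) (hi' : i ≤ 2 * m + 2) :
      |basisFun a b M i x * v (node a b M i)| ≤ K := by
    rw [abs_mul]
    exact (mul_le_of_le_one_left (abs_nonneg _) (abs_basisFun_le_one hh i x)).trans
      (hv _ ⟨hmono hi, hmono hi'⟩)
  rw [interpErr, interp_of_mem_cell hh hm hx]
  refine (abs_sub _ _).trans ?_
  linarith [hv x hx, abs_add_three (basisFun a b M (2 * m) x * v (node a b M (2 * m)))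
    (basisFun a b M (2 * m + 1) x * v (node a b M (2 * m + 1)))
    (basisFun a b M (2 * m + 2) x * v (node a b M (2 * m + 2))),
    hterm (2 * m) le_rfl (by omega), hterm (2 * m + 1) (by omega) (by omega),
    hterm (2 * m + 2) (by omega) le_rfl]

theorem interpErr_cubic (hh : 0 < meshSize a b M) (hm : m < M)
    (hx : x ∈ Icc (node a b M (2 * m)) (node a b M (2 * m + 2))) (c₀ c₁ c₂ c₃ : ℝ) :
    interpErr a b M (fun y => c₀ + c₁ * (y - node a b M (2 * m))
        + c₂ * (y - node a b M (2 * m)) ^ 2 + c₃ * (y - node a b M (2 * m)) ^ 3) x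
      = c₃ * ((x - node a b M (2 * m)) * (x - node a b M (2 * m + 1))
          * (x - node a b M (2 * m + 2))) := by
  have hx' := hx
  rw [node_add_two] at hx'
  rw [interpErr, interp_of_mem_cell hh hm hx, basisFun_of_even hh (by simp),
    basisFun_of_odd hh (by simp), basisFun_of_even hh (by simp [parity_simps]),
    node_add_one, node_add_two]
  set h := meshSize a b M
  set p := node a b M (2 * m)
  obtain ⟨s, rfl⟩ : ∃ s, x = p + s * h := ⟨(x - p) / h, by field_simp; ring⟩
  have hs₀ : 0 ≤ s := nonneg_of_mul_nonneg_left (by linarith [hx'.1]) hh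
  have hs₁ : s ≤ 1 := le_of_mul_le_mul_right (by linarith [hx'.2]) hh
  have hleft : |p + s * h - p| / h = s := by
    rw [add_sub_cancel_left, abs_of_nonneg (by positivity), mul_div_cancel_right₀ _ hh.ne']
  have hmid : (2 * |p + s * h - (p + h / 2)| / h) ^ 2 = (2 * s - 1) ^ 2 := by
    rw [div_pow, mul_pow, sq_abs]
    field_simp
    ring
  have hright : |p + s * h - (p + h)| / h = 1 - s := by
    rw [abs_of_nonpos (by nlinarith)]
    field_simp
    ring
  rw [hleft, hmid, hright, max_eq_right (by linarith), max_eq_right (by nlinarith),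
    max_eq_right (by linarith)]
  ring

theorem integral_nodal_cubic (p h : ℝ) :
    ∫ x in p..p + h, (x - p) * (x - (p + h / 2)) * (x - (p + h)) = 0 := by
  have hprimitive (x : ℝ) : HasDerivAt (fun x => (x - p) ^ 2 * (x - (p + h)) ^ 2 / 4)
      ((x - p) * (x - (p + h / 2)) * (x - (p + h))) x := by
    refine (((((hasDerivAt_id x).sub_const p).pow 2).mul
      (((hasDerivAt_id x).sub_const (p + h)).pow 2)).div_const 4).congr_deriv ?_
    simp only [id, Pi.pow_apply, Nat.cast_ofNat]
    ring
  rw [intervalIntegral.integral_eq_sub_of_hasDerivAt (fun x _ => hprimitive x)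
    (Continuous.intervalIntegrable (by fun_prop) _ _)]
  simp

end Interp

section CubicExpansion

variable {a b B x : ℝ} {M m : ℕ} {v : ℝ → ℝ}

/-- At every point of `[a, b]`, `v` has an expansion to the right by a cubic polynomial whose
leading coefficient and fourth order remainder are bounded by `B`. This is what the interpolation
error depends on, and unlike a bound on the fourth derivative it visibly passes to finite linear
combinations. -/
def HasCubicExpansion (a b B : ℝ) (v : ℝ → ℝ) : Prop :=
  ∀ p ∈ Icc a b, ∃ c₀ c₁ c₂ c₃ : ℝ, |c₃| ≤ B ∧ ∀ x ∈ Icc p b,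
    |v x - (c₀ + c₁ * (x - p) + c₂ * (x - p) ^ 2 + c₃ * (x - p) ^ 3)| ≤ B * (x - p) ^ 4

theorem HasBoundedDerivs.hasCubicExpansion (hv : HasBoundedDerivs 4 B v (Icc a b)) :
    HasCubicExpansion a b B v := by
  intro p hp
  have hB := hv.nonneg hp
  refine ⟨v p, iteratedDerivWithin 1 v (Icc a b) p, iteratedDerivWithin 2 v (Icc a b) p / 2,
    iteratedDerivWithin 3 v (Icc a b) p / 6, ?_, fun x hx => ?_⟩
  · rw [abs_div, abs_of_pos (by norm_num : (0 : ℝ) < 6)]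
    linarith [hv.abs_iteratedDerivWithin_le 3 (by norm_num) p hp]
  · have htaylor := hv.abs_sub_taylor_le hp hx
    norm_num [Finset.sum_range_succ, Nat.factorial] at htaylor
    have : 0 ≤ B * (x - p) ^ 4 := by positivity
    rw [iteratedDerivWithin_one]
    linarith

theorem HasCubicExpansion.sum_mul {ι : Type*} {s : Finset ι} {w : ι → ℝ} {f : ι → ℝ → ℝ} {K : ℝ}
    (hf : ∀ i ∈ s, HasCubicExpansion a b B (f i)) (hB : 0 ≤ B) (hw : ∑ i ∈ s, |w i| ≤ K) :
    HasCubicExpansion a b (K * B) fun x => ∑ i ∈ s, w i * f i x := by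
  have hsum {r : ι → ℝ} {R : ℝ} (hR : 0 ≤ R) (hr : ∀ i ∈ s, |r i| ≤ R) :
      |∑ i ∈ s, w i * r i| ≤ K * R := by
    refine (Finset.abs_sum_le_sum_abs _ _).trans
      (le_trans ?_ (mul_le_mul_of_nonneg_right hw hR))
    rw [Finset.sum_mul]
    refine Finset.sum_le_sum fun i hi => ?_
    rw [abs_mul]
    exact mul_le_mul_of_nonneg_left (hr i hi) (abs_nonneg _)
  intro p hp
  choose! c₀ c₁ c₂ c₃ hc₃ hc using fun i hi => hf i hi p hp
  refine ⟨∑ i ∈ s, w i * c₀ i, ∑ i ∈ s, w i * c₁ i, ∑ i ∈ s, w i * c₂ i, ∑ i ∈ s, w i * c₃ i,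
    hsum hB hc₃, fun x hx => ?_⟩
  convert hsum (by positivity) fun i hi => hc i hi x hx using 1
  · simp only [Finset.sum_mul, ← Finset.sum_add_distrib, ← Finset.sum_sub_distrib]
    congr! 2
    ring
  · ring

namespace HasCubicExpansion

theorem nonneg (hv : HasCubicExpansion a b B v) (hab : a ≤ b) : 0 ≤ B :=
  have ⟨_, _, _, _, hc₃, _⟩ := hv a (left_mem_Icc.2 hab)
  (abs_nonneg _).trans hc₃

theorem exists_abs_interpErr_sub_le (hv : HasCubicExpansion a b B v)
    (hh : 0 < meshSize a b M) (hm : m < M) :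
    ∃ α : ℝ, |α| ≤ B ∧ ∀ x ∈ Icc (node a b M (2 * m)) (node a b M (2 * m + 2)),
      |interpErr a b M v x - α * ((x - node a b M (2 * m)) * (x - node a b M (2 * m + 1))
          * (x - node a b M (2 * m + 2)))| ≤ 4 * (B * meshSize a b M ^ 4) := by
  obtain ⟨c₀, c₁, c₂, c₃, hc₃, hc⟩ := hv _ (node_mem_Icc (i := 2 * m) hh (by omega))
  have hB : 0 ≤ B := (abs_nonneg _).trans hc₃
  have hend := (node_mem_Icc (i := 2 * m + 2) hh (by omega)).2
  refine ⟨c₃, hc₃, fun x hx => ?_⟩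
  rw [← interpErr_cubic hh hm hx c₀ c₁ c₂ c₃]
  set P : ℝ → ℝ := fun y => c₀ + c₁ * (y - node a b M (2 * m))
    + c₂ * (y - node a b M (2 * m)) ^ 2 + c₃ * (y - node a b M (2 * m)) ^ 3
  have hsplit := interpErr_add a b M P (fun y => v y - P y) x
  simp only [add_sub_cancel] at hsplit
  rw [hsplit, add_sub_cancel_left]
  refine abs_interpErr_le_of_mem_cell hh hm hx fun y hy =>
    (hc y ⟨hy.1, hy.2.trans hend⟩).trans ?_
  rw [node_add_two] at hy
  have := sub_nonneg.2 hy.1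
  gcongr
  linarith [hy.2]

theorem abs_interpErr_le (hv : HasCubicExpansion a b B v) (hh : 0 < meshSize a b M)
    (hx : x ∈ Icc a b) :
    |interpErr a b M v x| ≤ B * (1 + 4 * (b - a)) * meshSize a b M ^ 3 := by
  have hle := meshSize_le hh
  obtain ⟨m, hm, hxm⟩ := exists_mem_cell hh hx
  obtain ⟨α, hα, hαerr⟩ := hv.exists_abs_interpErr_sub_le hh hm
  have hB : 0 ≤ B := (abs_nonneg _).trans hα
  have herr := hαerr x hxm
  simp only [node_add_two, mem_Icc] at herr hxm
  simp only [node_add_one] at herr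
  set h := meshSize a b M
  set p := node a b M (2 * m)
  have hcubic : |α * ((x - p) * (x - (p + h / 2)) * (x - (p + h)))| ≤ B * (h * h * h) := by
    rw [abs_mul, abs_mul, abs_mul]
    gcongr <;> exact abs_le.2 ⟨by linarith, by linarith⟩
  have hrest : B * h ^ 4 ≤ B * (b - a) * h ^ 3 := by
    rw [pow_succ' h 3, ← mul_assoc]
    gcongr
  rw [abs_le] at herr hcubic ⊢
  constructor <;> linarith

theorem abs_integral_cell_le (hv : HasCubicExpansion a b B v) (hvc : ContinuousOn v (Icc a b))
    (hh : 0 < meshSize a b M) (hm : m < M) :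
    |∫ x in node a b M (2 * m)..node a b M (2 * m + 2), interpErr a b M v x|
      ≤ 4 * (B * meshSize a b M ^ 4) * meshSize a b M := by
  obtain ⟨α, -, hα⟩ := hv.exists_abs_interpErr_sub_le hh hm
  have hint := intervalIntegrable_interpErr hh hvc (node_mem_Icc (i := 2 * m) hh (by omega))
    (node_mem_Icc (i := 2 * m + 2) hh (by omega))
  simp only [node_add_two] at hα hint ⊢
  simp only [node_add_one] at hα
  set h := meshSize a b M
  set p := node a b M (2 * m)
  have hsplit : ∫ x in p..p + h, interpErr a b M v x = ∫ x in p..p + h,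
      (interpErr a b M v x - α * ((x - p) * (x - (p + h / 2)) * (x - (p + h)))) := by
    rw [intervalIntegral.integral_sub hint (Continuous.intervalIntegrable (by fun_prop) _ _),
      intervalIntegral.integral_const_mul, integral_nodal_cubic, mul_zero, sub_zero]
  rw [hsplit]
  calc |∫ x in p..p + h,
        (interpErr a b M v x - α * ((x - p) * (x - (p + h / 2)) * (x - (p + h))))|
      ≤ 4 * (B * h ^ 4) * |p + h - p| :=
        intervalIntegral.norm_integral_le_of_norm_le_const
          (f := fun x => interpErr a b M v x - α * ((x - p) * (x - (p + h / 2)) * (x - (p + h))))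
          fun x hx => hα x (Ioc_subset_Icc_self (uIoc_of_le (le_add_of_nonneg_right hh.le) ▸ hx))
    _ = 4 * (B * h ^ 4) * h := by rw [add_sub_cancel_left, abs_of_pos hh]

theorem abs_integral_node_le (hv : HasCubicExpansion a b B v) (hvc : ContinuousOn v (Icc a b))
    (hh : 0 < meshSize a b M) (hm : m ≤ M) :
    |∫ x in a..node a b M (2 * m), interpErr a b M v x|
      ≤ m * (4 * (B * meshSize a b M ^ 4) * meshSize a b M) := by
  have hsum := intervalIntegral.sum_integral_adjacent_intervals (n := m)
    (a := fun k => node a b M (2 * k)) fun k hk => intervalIntegrable_interpErr hh hvc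
      (node_mem_Icc hh (by omega)) (node_mem_Icc hh (by omega))
  rw [mul_zero, node_zero] at hsum
  rw [← hsum]
  refine (Finset.abs_sum_le_sum_abs _ _).trans ((Finset.sum_le_card_nsmul _ _ _ fun k hk =>
    hv.abs_integral_cell_le hvc hh ((Finset.mem_range.1 hk).trans_le hm)).trans ?_)
  rw [Finset.card_range, nsmul_eq_mul]

theorem abs_integral_le (hv : HasCubicExpansion a b B v) (hvc : ContinuousOn v (Icc a b))
    (hh : 0 < meshSize a b M) (hx : x ∈ Icc a b) :
    |∫ s in a..x, interpErr a b M v s| ≤ B * (1 + 8 * (b - a)) * meshSize a b M ^ 4 := by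
  obtain ⟨hab, hM⟩ := meshSize_pos_iff.1 hh
  have hB := hv.nonneg hab.le
  obtain ⟨m, hm, hxm⟩ := exists_mem_cell hh hx
  have hp : node a b M (2 * m) ∈ Icc a b := node_mem_Icc hh (by omega)
  have hcells : |∫ s in a..node a b M (2 * m), interpErr a b M v s|
      ≤ 4 * (B * meshSize a b M ^ 4) * (b - a) := by
    refine (hv.abs_integral_node_le hvc hh hm.le).trans ?_
    rw [mul_left_comm, ← mul_meshSize hM]
    gcongr
  have hrest : |∫ s in node a b M (2 * m)..x, interpErr a b M v s|
      ≤ B * (1 + 4 * (b - a)) * meshSize a b M ^ 3 * meshSize a b M := by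
    have hbound := intervalIntegral.norm_integral_le_of_norm_le_const (a := node a b M (2 * m))
      (b := x) (f := interpErr a b M v) fun s hs => hv.abs_interpErr_le hh (x := s) (by
        rw [uIoc_of_le hxm.1] at hs
        exact ⟨hp.1.trans hs.1.le, hs.2.trans hx.2⟩)
    refine hbound.trans ?_
    have : 0 < b - a := sub_pos.2 hab
    rw [abs_of_nonneg (sub_nonneg.2 hxm.1)]
    gcongr
    linarith [hxm.2, node_add_two a b M (2 * m)]
  rw [← intervalIntegral.integral_add_adjacent_intervals
    (intervalIntegrable_interpErr hh hvc (left_mem_Icc.2 hab.le) hp)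
    (intervalIntegrable_interpErr hh hvc hp hx)]
  linarith [abs_add_le (∫ s in a..node a b M (2 * m), interpErr a b M v s)
    (∫ s in node a b M (2 * m)..x, interpErr a b M v s)]

end HasCubicExpansion

end CubicExpansion

/-! ### Integration against a weakly singular kernel -/

theorem abs_integral_mul_le_of_antitone {p q η : ℝ} {E K K' : ℝ → ℝ} (hpq : p ≤ q)
    (hE : ContinuousOn E (Icc p q)) (hη : ∀ x ∈ Icc p q, |∫ s in p..x, E s| ≤ η)
    (hK : ∀ x ∈ Icc p q, HasDerivAt K (K' x) x) (hK' : ContinuousOn K' (Icc p q))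
    (hnonpos : ∀ x ∈ Icc p q, K' x ≤ 0) (hnonneg : 0 ≤ K q) :
    |∫ x in p..q, K x * E x| ≤ η * K p := by
  have hEi : IntervalIntegrable E volume p q := hE.intervalIntegrable_of_Icc hpq
  have hK'i : IntervalIntegrable K' volume p q := hK'.intervalIntegrable_of_Icc hpq
  have hprimitive (x : ℝ) (hx : x ∈ Ioo p q) : HasDerivAt (fun x => ∫ s in p..x, E s) (E x) x :=
    intervalIntegral.integral_hasDerivAt_right
      ((hE.mono (Icc_subset_Icc_right hx.2.le)).intervalIntegrable_of_Icc hx.1.le)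
      ((hE.mono Ioo_subset_Icc_self).stronglyMeasurableAtFilter isOpen_Ioo x hx)
      (hE.continuousAt (Icc_mem_nhds hx.1 hx.2))
  have hparts : ∫ x in p..q, K x * E x
      = K q * (∫ s in p..q, E s) - ∫ x in p..q, K' x * ∫ s in p..x, E s := by
    rw [intervalIntegral.integral_mul_deriv_eq_deriv_mul_of_hasDerivAt
      (v := fun x => ∫ s in p..x, E s)
      (uIcc_of_le hpq ▸ fun x hx => (hK x hx).continuousAt.continuousWithinAt)
      (intervalIntegral.continuousOn_primitive_interval' hEi left_mem_uIcc)
      (by simpa only [min_eq_left hpq, max_eq_right hpq] using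
        fun x hx => hK x (Ioo_subset_Icc_self hx))
      (by simpa only [min_eq_left hpq, max_eq_right hpq] using hprimitive) hK'i hEi,
      intervalIntegral.integral_same, mul_zero, sub_zero]
  have hboundary : |K q * ∫ s in p..q, E s| ≤ η * K q := by
    rw [abs_mul, abs_of_nonneg hnonneg, mul_comm]
    exact mul_le_mul_of_nonneg_right (hη q (right_mem_Icc.2 hpq)) hnonneg
  have hintegral : |∫ x in p..q, K' x * ∫ s in p..x, E s| ≤ ∫ x in p..q, η * -K' x := by
    refine intervalIntegral.norm_integral_le_of_norm_le (f := fun x => K' x * ∫ s in p..x, E s)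
      hpq (.of_forall fun x hx => ?_) (hK'i.neg.const_mul η)
    have hx' := Ioc_subset_Icc_self hx
    rw [Real.norm_eq_abs, abs_mul, abs_of_nonpos (hnonpos x hx'), mul_comm]
    exact mul_le_mul_of_nonneg_right (hη x hx') (neg_nonneg.2 (hnonpos x hx'))
  rw [intervalIntegral.integral_const_mul, intervalIntegral.integral_neg,
    intervalIntegral.integral_eq_sub_of_hasDerivAt (uIcc_of_le hpq ▸ hK) hK'i] at hintegral
  rw [hparts]
  linarith [abs_sub (K q * ∫ s in p..q, E s) (∫ x in p..q, K' x * ∫ s in p..x, E s)]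

/-- A decreasing kernel on `(0, ∞)` that blows up at `0` at most as fast as `s ^ (-γ)`. The value
at `0` is arbitrary. -/
structure IsWeaklySingular (γ : ℝ) (k : ℝ → ℝ) : Prop where
  contDiffOn : ContDiffOn ℝ 1 k (Ioi 0)
  antitoneOn : AntitoneOn k (Ioi 0)
  nonneg : ∀ s, 0 < s → 0 ≤ k s
  le_rpow : ∀ s, 0 < s → k s ≤ s ^ (-γ)

/-- The constant in the superconvergence estimate for a weakly singular integral of the
interpolation error. -/
noncomputable def interpConst (γ a b : ℝ) : ℝ := 2 * (1 + 8 * (b - a)) * (1 / (1 - γ) + 4)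

theorem interpConst_nonneg {γ a b : ℝ} (hγ : γ ≤ 1) (hab : a ≤ b) : 0 ≤ interpConst γ a b := by
  have hγ' : 0 ≤ 1 - γ := sub_nonneg.2 hγ
  have hx : 0 ≤ b - a := sub_nonneg.2 hab
  unfold interpConst
  positivity

namespace IsWeaklySingular

variable {γ a b h z ℓ ε η : ℝ} {k E : ℝ → ℝ}

theorem intervalIntegrable (hk : IsWeaklySingular γ k) (hγ : γ < 1) (hℓ : 0 ≤ ℓ) :
    IntervalIntegrable k volume 0 ℓ := by
  refine (intervalIntegral.intervalIntegrable_rpow' (neg_lt_neg hγ)).mono_fun ?_ ?_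
  · rw [uIoc_of_le hℓ]
    exact (hk.contDiffOn.continuousOn.mono Ioc_subset_Ioi_self).aestronglyMeasurable
      measurableSet_Ioc
  · rw [uIoc_of_le hℓ]
    filter_upwards [ae_restrict_mem measurableSet_Ioc] with s hs
    rw [Real.norm_of_nonneg (hk.nonneg s hs.1), Real.norm_of_nonneg (by have := hs.1; positivity)]
    exact hk.le_rpow s hs.1

theorem integral_le (hk : IsWeaklySingular γ k) (hγ : γ < 1) (hℓ : 0 ≤ ℓ) :
    ∫ s in 0..ℓ, k s ≤ ℓ ^ (1 - γ) / (1 - γ) := by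
  have hrpow : ∫ s in 0..ℓ, s ^ (-γ) = ℓ ^ (1 - γ) / (1 - γ) := by
    rw [integral_rpow (.inl (neg_lt_neg hγ)), neg_add_eq_sub,
      Real.zero_rpow (sub_pos.2 hγ).ne', sub_zero]
  rw [← hrpow]
  exact intervalIntegral.integral_mono_on_of_le_Ioo hℓ (hk.intervalIntegrable hγ hℓ)
    (intervalIntegral.intervalIntegrable_rpow' (neg_lt_neg hγ)) fun s hs => hk.le_rpow s hs.1

theorem abs_integral_mul_le_near (hk : IsWeaklySingular γ k) (hγ : γ < 1) (hℓ : 0 ≤ ℓ)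
    (hε : ∀ s ∈ Icc 0 ℓ, |E s| ≤ ε) :
    |∫ s in 0..ℓ, k s * E s| ≤ ε * (ℓ ^ (1 - γ) / (1 - γ)) := by
  have hε₀ : 0 ≤ ε := (abs_nonneg _).trans (hε 0 (left_mem_Icc.2 hℓ))
  calc |∫ s in 0..ℓ, k s * E s| ≤ ∫ s in 0..ℓ, ε * k s := by
        refine intervalIntegral.norm_integral_le_of_norm_le (f := fun s => k s * E s) hℓ
          (.of_forall fun s hs => ?_) ((hk.intervalIntegrable hγ hℓ).const_mul ε)
        rw [Real.norm_eq_abs, abs_mul, abs_of_nonneg (hk.nonneg s hs.1), mul_comm]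
        exact mul_le_mul_of_nonneg_right (hε s (Ioc_subset_Icc_self hs)) (hk.nonneg s hs.1)
    _ ≤ ε * (ℓ ^ (1 - γ) / (1 - γ)) := by
        rw [intervalIntegral.integral_const_mul]
        exact mul_le_mul_of_nonneg_left (hk.integral_le hγ hℓ) hε₀

theorem abs_integral_mul_le_far (hk : IsWeaklySingular γ k) (hh : 0 < h) (hhℓ : h ≤ ℓ)
    (hE : ContinuousOn E (Icc h ℓ)) (hη : ∀ x ∈ Icc h ℓ, |∫ s in h..x, E s| ≤ η) :
    |∫ s in h..ℓ, k s * E s| ≤ η * h ^ (-γ) := by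
  have hsub : Icc h ℓ ⊆ Ioi 0 := fun s hs => hh.trans_le hs.1
  have hη₀ : 0 ≤ η := (abs_nonneg _).trans (hη h (left_mem_Icc.2 hhℓ))
  refine (abs_integral_mul_le_of_antitone (K' := deriv k) hhℓ hE hη ?_ ?_ ?_
    (hk.nonneg ℓ (hh.trans_le hhℓ))).trans
    (mul_le_mul_of_nonneg_left (hk.le_rpow h hh) hη₀)
  · exact fun s hs => ((hk.contDiffOn.differentiableOn one_ne_zero).differentiableAt
      (Ioi_mem_nhds (hsub hs))).hasDerivAt
  · exact (hk.contDiffOn.continuousOn_deriv_of_isOpen isOpen_Ioi le_rfl).mono hsub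
  · intro s hs
    rw [← derivWithin_of_isOpen isOpen_Ioi (hsub hs)]
    exact hk.antitoneOn.derivWithin_nonpos

theorem abs_integral_mul_le (hk : IsWeaklySingular γ k) (hγ : γ < 1) (hh : 0 < h) (hℓ : 0 ≤ ℓ)
    (hE : ContinuousOn E (Icc 0 ℓ)) (hε : ∀ s ∈ Icc 0 ℓ, |E s| ≤ ε)
    (hη : ∀ x ∈ Icc 0 ℓ, |∫ s in 0..x, E s| ≤ η) :
    |∫ s in 0..ℓ, k s * E s| ≤ ε * (h ^ (1 - γ) / (1 - γ)) + 2 * η * h ^ (-γ) := by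
  have hγ' : 0 < 1 - γ := sub_pos.2 hγ
  have h₀ : (0 : ℝ) ∈ Icc 0 ℓ := left_mem_Icc.2 hℓ
  have hε₀ : 0 ≤ ε := (abs_nonneg _).trans (hε 0 h₀)
  have hη₀ : 0 ≤ η := (abs_nonneg _).trans (hη 0 h₀)
  rcases le_total ℓ h with hℓh | hhℓ
  · refine (hk.abs_integral_mul_le_near hγ hℓ hε).trans
      (le_trans ?_ (le_add_of_nonneg_right (by positivity)))
    gcongr
  have hint {x : ℝ} (hx : x ∈ Icc 0 ℓ) : IntervalIntegrable E volume 0 x :=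
    (hE.mono (Icc_subset_Icc_right hx.2)).intervalIntegrable_of_Icc hx.1
  have hhmem : h ∈ Icc 0 ℓ := ⟨hh.le, hhℓ⟩
  have hnear := hk.abs_integral_mul_le_near hγ hh.le fun s hs => hε s ⟨hs.1, hs.2.trans hhℓ⟩
  have hfar := hk.abs_integral_mul_le_far (η := 2 * η) hh hhℓ
    (hE.mono (Icc_subset_Icc_left hh.le)) fun x hx => by
      have hx' : x ∈ Icc 0 ℓ := ⟨hh.le.trans hx.1, hx.2⟩
      rw [← intervalIntegral.integral_interval_sub_left (hint hx') (hint hhmem)]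
      linarith [abs_sub (∫ s in 0..x, E s) (∫ s in 0..h, E s), hη x hx', hη h hhmem]
  have hkE : IntervalIntegrable (fun s => k s * E s) volume 0 ℓ :=
    (hk.intervalIntegrable hγ hℓ).mul_continuousOn (uIcc_of_le hℓ ▸ hE)
  rw [← intervalIntegral.integral_add_adjacent_intervals
    (hkE.mono_set (uIcc_subset_uIcc left_mem_uIcc (uIcc_of_le hℓ ▸ hhmem)))
    (hkE.mono_set (uIcc_subset_uIcc (uIcc_of_le hℓ ▸ hhmem) right_mem_uIcc))]
  exact (abs_add_le _ _).trans (add_le_add hnear hfar)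

theorem intervalIntegrable_abs_sub (hk : IsWeaklySingular γ k) (hγ : γ < 1)
    (hz : z ∈ Icc a b) : IntervalIntegrable (fun x => k |z - x|) volume a b := by
  have hleft := (hk.intervalIntegrable hγ (sub_nonneg.2 hz.1)).comp_sub_left z
  have hright := (hk.intervalIntegrable hγ (sub_nonneg.2 hz.2)).comp_sub_right z
  rw [sub_zero, sub_sub_cancel] at hleft
  rw [zero_add, sub_add_cancel] at hright
  refine .trans (b := z) (hleft.symm.congr fun x hx => ?_) (hright.congr fun x hx => ?_)
  · rw [uIoc_of_le hz.1] at hx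
    simp only [abs_of_nonneg (sub_nonneg.2 hx.2)]
  · rw [uIoc_of_le hz.2] at hx
    simp only [abs_of_nonpos (sub_nonpos.2 hx.1.le), neg_sub]

theorem integral_abs_sub_mul (hk : IsWeaklySingular γ k) (hγ : γ < 1) (hz : z ∈ Icc a b)
    (hE : ContinuousOn E (Icc a b)) :
    ∫ x in a..b, k |z - x| * E x
      = (∫ s in 0..z - a, k s * E (z - s)) + ∫ s in 0..b - z, k s * E (z + s) := by
  have hab : a ≤ b := hz.1.trans hz.2
  have hint : IntervalIntegrable (fun x => k |z - x| * E x) volume a b :=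
    (hk.intervalIntegrable_abs_sub hγ hz).mul_continuousOn (uIcc_of_le hab ▸ hE)
  have hz' := uIcc_of_le hab ▸ hz
  have hleft := intervalIntegral.integral_comp_sub_left (fun x => k |z - x| * E x)
    (a := 0) (b := z - a) z
  have hright := intervalIntegral.integral_comp_add_left (fun x => k |z - x| * E x)
    (a := 0) (b := b - z) z
  rw [sub_zero, sub_sub_cancel] at hleft
  rw [add_zero, add_sub_cancel] at hright
  rw [← intervalIntegral.integral_add_adjacent_intervals
    (hint.mono_set (uIcc_subset_uIcc left_mem_uIcc hz'))
    (hint.mono_set (uIcc_subset_uIcc hz' right_mem_uIcc)), ← hleft, ← hright]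
  congr 1 <;> refine intervalIntegral.integral_congr fun s hs => ?_
  · rw [uIcc_of_le (sub_nonneg.2 hz.1)] at hs
    simp only [sub_sub_cancel, abs_of_nonneg hs.1]
  · rw [uIcc_of_le (sub_nonneg.2 hz.2)] at hs
    simp only [sub_add_cancel_left, abs_neg, abs_of_nonneg hs.1]

theorem integral_abs_sub_le (hk : IsWeaklySingular γ k) (hγ : γ < 1) (hz : z ∈ Icc a b) :
    ∫ x in a..b, k |z - x| ≤ 2 * (b - a) ^ (1 - γ) / (1 - γ) := by
  have hza := sub_nonneg.2 hz.1
  have hzb := sub_nonneg.2 hz.2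
  have hγ' : 0 < 1 - γ := sub_pos.2 hγ
  have hsplit := hk.integral_abs_sub_mul hγ hz (E := fun _ => 1) continuousOn_const
  simp only [mul_one] at hsplit
  have hleft : (z - a) ^ (1 - γ) / (1 - γ) ≤ (b - a) ^ (1 - γ) / (1 - γ) := by
    gcongr
    exact hz.2
  have hright : (b - z) ^ (1 - γ) / (1 - γ) ≤ (b - a) ^ (1 - γ) / (1 - γ) := by
    gcongr
    exact hz.1
  rw [hsplit, mul_div_assoc]
  linarith [hk.integral_le hγ hza, hk.integral_le hγ hzb]

theorem abs_integral_abs_sub_mul_le (hk : IsWeaklySingular γ k) (hγ : γ < 1) (hh : 0 < h)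
    (hz : z ∈ Icc a b) (hE : ContinuousOn E (Icc a b)) (hε : ∀ x ∈ Icc a b, |E x| ≤ ε)
    (hη : ∀ x ∈ Icc a b, |∫ s in a..x, E s| ≤ η) :
    |∫ x in a..b, k |z - x| * E x|
      ≤ 2 * (ε * (h ^ (1 - γ) / (1 - γ)) + 4 * η * h ^ (-γ)) := by
  have hprimitive {p q : ℝ} (hp : p ∈ Icc a b) (hq : q ∈ Icc a b) :
      |∫ s in p..q, E s| ≤ 2 * η := by
    have hint {r : ℝ} (hr : r ∈ Icc a b) : IntervalIntegrable E volume a r :=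
      (hE.mono (Icc_subset_Icc_right hr.2)).intervalIntegrable_of_Icc hr.1
    rw [← intervalIntegral.integral_interval_sub_left (hint hq) (hint hp)]
    linarith [abs_sub (∫ s in a..q, E s) (∫ s in a..p, E s), hη p hp, hη q hq]
  have hleft (s : ℝ) (hs : s ∈ Icc 0 (z - a)) : z - s ∈ Icc a b :=
    ⟨by linarith [hs.2], by linarith [hs.1, hz.2]⟩
  have hright (s : ℝ) (hs : s ∈ Icc 0 (b - z)) : z + s ∈ Icc a b :=
    ⟨by linarith [hs.1, hz.1], by linarith [hs.2]⟩
  have hintleft := hk.abs_integral_mul_le (E := fun s => E (z - s)) (η := 2 * η) hγ hh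
    (sub_nonneg.2 hz.1)
    (hE.comp (by fun_prop) hleft) (fun s hs => hε _ (hleft s hs)) fun s hs => by
      rw [intervalIntegral.integral_comp_sub_left E z, sub_zero]
      exact hprimitive (hleft s hs) hz
  have hintright := hk.abs_integral_mul_le (E := fun s => E (z + s)) (η := 2 * η) hγ hh
    (sub_nonneg.2 hz.2)
    (hE.comp (by fun_prop) hright) (fun s hs => hε _ (hright s hs)) fun s hs => by
      rw [intervalIntegral.integral_comp_add_left E z, add_zero]
      exact hprimitive hz (hright s hs)
  rw [hk.integral_abs_sub_mul hγ hz hE]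
  refine (abs_add_le _ _).trans ((add_le_add hintleft hintright).trans_eq ?_)
  ring

theorem abs_integral_abs_sub_mul_interpErr_le {B : ℝ} {M : ℕ} {v : ℝ → ℝ}
    (hk : IsWeaklySingular γ k) (hγ : γ < 1) (hh : 0 < meshSize a b M) (hz : z ∈ Icc a b)
    (hv : HasCubicExpansion a b B v) (hvc : ContinuousOn v (Icc a b)) :
    |∫ x in a..b, k |z - x| * interpErr a b M v x|
      ≤ interpConst γ a b * B * meshSize a b M ^ (4 - γ) := by
  have hab := (meshSize_pos_iff.1 hh).1
  have hB := hv.nonneg hab.le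
  have hε (x : ℝ) (hx : x ∈ Icc a b) :
      |interpErr a b M v x| ≤ B * (1 + 8 * (b - a)) * meshSize a b M ^ 3 := by
    refine (hv.abs_interpErr_le hh hx).trans ?_
    gcongr
    linarith
  refine (hk.abs_integral_abs_sub_mul_le hγ hh hz (continuousOn_interpErr hh hvc) hε
    fun x hx => hv.abs_integral_le hvc hh hx).trans_eq ?_
  have hpow₃ : meshSize a b M ^ (4 - γ) = meshSize a b M ^ 3 * meshSize a b M ^ (1 - γ) := by
    rw [← Real.rpow_natCast, ← Real.rpow_add hh]
    norm_num [← add_sub_assoc]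
  have hpow₄ : meshSize a b M ^ (4 - γ) = meshSize a b M ^ 4 * meshSize a b M ^ (-γ) := by
    rw [← Real.rpow_natCast, ← Real.rpow_add hh]
    norm_num [← sub_eq_add_neg]
  calc _ = 2 * (B * (1 + 8 * (b - a))) * (meshSize a b M ^ 3 * meshSize a b M ^ (1 - γ)
        * (1 / (1 - γ)) + 4 * (meshSize a b M ^ 4 * meshSize a b M ^ (-γ))) := by ring
    _ = _ := by
      rw [← hpow₃, ← hpow₄, interpConst]
      ring

end IsWeaklySingular

/-! ### The kernel on the rectangle -/

section Kernel

variable {γ : ℝ}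

theorem one_div_delta (γ s t : ℝ) : 1 / delta γ s t = (s ^ 2 + t ^ 2) ^ (-(γ / 2)) := by
  have hst : 0 ≤ s ^ 2 + t ^ 2 := by positivity
  rw [delta, abs_of_nonneg (Real.sqrt_nonneg _), Real.sqrt_eq_rpow, ← Real.rpow_mul hst, one_div,
    ← Real.rpow_neg hst, one_div_mul_eq_div]

theorem delta_comm (γ s t : ℝ) : delta γ s t = delta γ t s := by rw [delta, delta, add_comm]

theorem delta_abs_left (γ s t : ℝ) : delta γ |s| t = delta γ s t := by
  rw [delta, delta, sq_abs]

theorem one_div_delta_nonneg (γ s t : ℝ) : 0 ≤ 1 / delta γ s t := by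
  rw [one_div_delta]
  positivity

theorem measurable_one_div_delta (γ : ℝ) :
    Measurable fun q : ℝ × ℝ => 1 / delta γ q.1 q.2 := by
  simp only [one_div_delta]
  fun_prop

theorem one_div_delta_le_zero_right {s : ℝ} (hγ : 0 ≤ γ) (hs : s ≠ 0) (t : ℝ) :
    1 / delta γ s t ≤ 1 / delta γ s 0 := by
  rw [one_div_delta, one_div_delta]
  exact Real.rpow_le_rpow_of_nonpos (by positivity) (by linarith [sq_nonneg t]) (by linarith)

theorem one_div_delta_zero_right {s : ℝ} (hs : 0 ≤ s) : 1 / delta γ s 0 = s ^ (-γ) := by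
  rw [one_div_delta, zero_pow two_ne_zero, add_zero, ← Real.rpow_natCast, ← Real.rpow_mul hs,
    Nat.cast_two, mul_neg, mul_div_cancel₀ _ two_ne_zero]

theorem isWeaklySingular_one_div_delta (hγ : 0 ≤ γ) (t : ℝ) :
    IsWeaklySingular γ fun s => 1 / delta γ s t where
  contDiffOn := by
    simp only [one_div_delta]
    exact ContDiffOn.rpow_const_of_ne (by fun_prop) fun s hs => by
      have : 0 < s := hs
      positivity
  antitoneOn := fun r hr s _ hrs => by
    have : 0 < r := hr
    simp only [one_div_delta]
    exact Real.rpow_le_rpow_of_nonpos (by positivity) (by gcongr) (by linarith)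
  nonneg := fun s _ => one_div_delta_nonneg γ s t
  le_rpow := fun s hs =>
    (one_div_delta_le_zero_right hγ hs.ne' t).trans_eq (one_div_delta_zero_right hs.le)

end Kernel

section Potential

variable {γ a b c d x y K : ℝ} {F G : ℝ × ℝ → ℝ}

theorem volume_restrict_Omega (a b c d : ℝ) :
    (volume : Measure (ℝ × ℝ)).restrict (Omega a b c d)
      = (volume.restrict (Ioo a b)).prod (volume.restrict (Ioo c d)) := by
  rw [Omega, Measure.volume_eq_prod, Measure.prod_restrict]

theorem measurableSet_Omega (a b c d : ℝ) : MeasurableSet (Omega a b c d) :=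
  measurableSet_Ioo.prod measurableSet_Ioo

theorem Omega_subset_Icc_prod (a b c d : ℝ) : Omega a b c d ⊆ Icc a b ×ˢ Icc c d :=
  prod_mono Ioo_subset_Icc_self Ioo_subset_Icc_self

theorem integrableOn_one_div_delta_snd (hγ₀ : 0 ≤ γ) (hγ₁ : γ < 1) (a b : ℝ)
    (hy : y ∈ Icc c d) :
    IntegrableOn (fun q : ℝ × ℝ => 1 / delta γ (y - q.2) 0) (Omega a b c d) := by
  have hslice := (isWeaklySingular_one_div_delta hγ₀ 0).intervalIntegrable_abs_sub hγ₁ hy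
  simp only [delta_abs_left] at hslice
  rw [intervalIntegrable_iff_integrableOn_Ioo_of_le (hy.1.trans hy.2)] at hslice
  rw [IntegrableOn, volume_restrict_Omega]
  exact hslice.integrable.comp_snd _

theorem ae_one_div_delta_le (hγ : 0 ≤ γ) (x y : ℝ) :
    ∀ᵐ q : ℝ × ℝ, 1 / delta γ (x - q.1) (y - q.2) ≤ 1 / delta γ (y - q.2) 0 := by
  have hne : ∀ᵐ q : ℝ × ℝ, q.2 ≠ y :=
    Measure.quasiMeasurePreserving_snd.ae (Measure.ae_ne volume y)
  filter_upwards [hne] with q hq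
  rw [delta_comm]
  exact one_div_delta_le_zero_right hγ (sub_ne_zero.2 hq.symm) _

theorem integrableOn_one_div_delta (hγ₀ : 0 ≤ γ) (hγ₁ : γ < 1) (a b x : ℝ) (hy : y ∈ Icc c d) :
    IntegrableOn (fun q : ℝ × ℝ => 1 / delta γ (x - q.1) (y - q.2)) (Omega a b c d) := by
  refine (integrableOn_one_div_delta_snd hγ₀ hγ₁ a b hy).mono' ?_ ?_
  · exact ((measurable_one_div_delta γ).comp
      (f := fun q : ℝ × ℝ => (x - q.1, y - q.2)) (by fun_prop)).aestronglyMeasurable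
  · filter_upwards [ae_restrict_of_ae (ae_one_div_delta_le hγ₀ x y)] with q hq
    rwa [Real.norm_of_nonneg (one_div_delta_nonneg _ _ _)]

theorem integral_one_div_delta_le (hγ₀ : 0 ≤ γ) (hγ₁ : γ < 1) (hab : a ≤ b) (x : ℝ)
    (hy : y ∈ Icc c d) :
    ∫ q in Omega a b c d, 1 / delta γ (x - q.1) (y - q.2) ≤ constCd γ a b c d := by
  have hcd : c ≤ d := hy.1.trans hy.2
  calc ∫ q in Omega a b c d, 1 / delta γ (x - q.1) (y - q.2)
      ≤ ∫ q in Omega a b c d, 1 / delta γ (y - q.2) 0 :=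
        integral_mono_ae (integrableOn_one_div_delta hγ₀ hγ₁ a b x hy)
          (integrableOn_one_div_delta_snd hγ₀ hγ₁ a b hy)
          (ae_restrict_of_ae (ae_one_div_delta_le hγ₀ x y))
    _ = (b - a) * ∫ s in c..d, 1 / delta γ |y - s| 0 := by
        rw [volume_restrict_Omega, integral_fun_snd fun s => 1 / delta γ (y - s) 0,
          intervalIntegral.integral_of_le hcd, integral_Ioc_eq_integral_Ioo]
        simp [hab, delta_abs_left]
    _ ≤ (b - a) * (2 * (d - c) ^ (1 - γ) / (1 - γ)) :=
        mul_le_mul_of_nonneg_left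
          ((isWeaklySingular_one_div_delta hγ₀ 0).integral_abs_sub_le hγ₁ hy) (sub_nonneg.2 hab)
    _ = constCd γ a b c d := by
        rw [constCd]
        ring

/-- The potential at `(x, y)` of the density `F` on the rectangle, for the kernel `1 / δ`. The
collocation coefficients and the integral operator are all values of it. -/
noncomputable def potential (γ a b c d x y : ℝ) (F : ℝ × ℝ → ℝ) : ℝ :=
  ∫ q in Omega a b c d, F q / delta γ (x - q.1) (y - q.2)

theorem integrableOn_div_delta (hγ₀ : 0 ≤ γ) (hγ₁ : γ < 1) (x : ℝ) (hy : y ∈ Icc c d)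
    (hF : ContinuousOn F (Icc a b ×ˢ Icc c d)) :
    IntegrableOn (fun q => F q / delta γ (x - q.1) (y - q.2)) (Omega a b c d) := by
  obtain ⟨K, hK⟩ := (isCompact_Icc.prod isCompact_Icc).exists_bound_of_continuousOn hF
  have hsub := Omega_subset_Icc_prod a b c d
  simp only [div_eq_mul_one_div (F _)]
  refine (integrableOn_one_div_delta hγ₀ hγ₁ a b x hy).bdd_mul
    ((hF.mono hsub).aestronglyMeasurable (measurableSet_Omega a b c d)) (c := K) ?_
  filter_upwards [ae_restrict_mem (measurableSet_Omega a b c d)] with q hq using hK q (hsub hq)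

theorem potential_add (hγ₀ : 0 ≤ γ) (hγ₁ : γ < 1) (x : ℝ) (hy : y ∈ Icc c d)
    (hF : ContinuousOn F (Icc a b ×ˢ Icc c d)) (hG : ContinuousOn G (Icc a b ×ˢ Icc c d)) :
    potential γ a b c d x y (fun q => F q + G q)
      = potential γ a b c d x y F + potential γ a b c d x y G := by
  simp only [potential, add_div]
  exact integral_add (integrableOn_div_delta hγ₀ hγ₁ x hy hF)
    (integrableOn_div_delta hγ₀ hγ₁ x hy hG)

theorem potential_sub (hγ₀ : 0 ≤ γ) (hγ₁ : γ < 1) (x : ℝ) (hy : y ∈ Icc c d)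
    (hF : ContinuousOn F (Icc a b ×ˢ Icc c d)) (hG : ContinuousOn G (Icc a b ×ˢ Icc c d)) :
    potential γ a b c d x y (fun q => F q - G q)
      = potential γ a b c d x y F - potential γ a b c d x y G := by
  simp only [potential, sub_div]
  exact integral_sub (integrableOn_div_delta hγ₀ hγ₁ x hy hF)
    (integrableOn_div_delta hγ₀ hγ₁ x hy hG)

theorem potential_sum_mul {ι : Type*} {s : Finset ι} {F : ι → ℝ × ℝ → ℝ} (hγ₀ : 0 ≤ γ)
    (hγ₁ : γ < 1) (x : ℝ) (hy : y ∈ Icc c d)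
    (hF : ∀ i ∈ s, ContinuousOn (F i) (Icc a b ×ˢ Icc c d)) (w : ι → ℝ) :
    potential γ a b c d x y (fun q => ∑ i ∈ s, F i q * w i)
      = ∑ i ∈ s, potential γ a b c d x y (F i) * w i := by
  simp only [potential, Finset.sum_div, mul_div_right_comm _ (w _)]
  rw [integral_finsetSum _ fun i hi =>
    (integrableOn_div_delta hγ₀ hγ₁ x hy (hF i hi)).mul_const (w i)]
  simp only [integral_mul_const]

theorem abs_potential_le (hγ₀ : 0 ≤ γ) (hγ₁ : γ < 1) (hab : a ≤ b) (x : ℝ) (hy : y ∈ Icc c d)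
    (hK : ∀ q ∈ Icc a b ×ˢ Icc c d, |F q| ≤ K) :
    |potential γ a b c d x y F| ≤ K * constCd γ a b c d := by
  have hK₀ : 0 ≤ K := (abs_nonneg _).trans (hK (a, y) ⟨left_mem_Icc.2 hab, hy⟩)
  calc |potential γ a b c d x y F|
      ≤ ∫ q in Omega a b c d, K * (1 / delta γ (x - q.1) (y - q.2)) := by
        refine norm_integral_le_of_norm_le (f := fun q => F q / delta γ (x - q.1) (y - q.2))
          ((integrableOn_one_div_delta hγ₀ hγ₁ a b x hy).const_mul K) ?_
        filter_upwards [ae_restrict_mem (measurableSet_Omega a b c d)] with q hq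
        rw [div_eq_mul_one_div, norm_mul, Real.norm_of_nonneg (one_div_delta_nonneg _ _ _)]
        exact mul_le_mul_of_nonneg_right (hK q (Omega_subset_Icc_prod a b c d hq))
          (one_div_delta_nonneg _ _ _)
    _ ≤ K * constCd γ a b c d := by
        rw [integral_const_mul]
        exact mul_le_mul_of_nonneg_left (integral_one_div_delta_le hγ₀ hγ₁ hab x hy) hK₀

theorem potential_swap (γ a b c d x y : ℝ) (F : ℝ × ℝ → ℝ) :
    potential γ c d a b y x (fun q => F q.swap) = potential γ a b c d x y F := by
  simp only [potential, Omega, delta_comm γ (y - _)]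
  exact setIntegral_prod_swap (μ := volume) (ν := volume) (Ioo a b) (Ioo c d)
    fun q => F q / delta γ (x - q.1) (y - q.2)

theorem abs_potential_le_of_forall_fst (hγ₀ : 0 ≤ γ) (hγ₁ : γ < 1) (hab : a ≤ b) (x : ℝ)
    (hy : y ∈ Icc c d) (hF : ContinuousOn F (Icc a b ×ˢ Icc c d))
    (hK : ∀ s ∈ Icc c d, |∫ r in a..b, 1 / delta γ (x - r) (y - s) * F (r, s)| ≤ K) :
    |potential γ a b c d x y F| ≤ K * (d - c) := by
  have hint := integrableOn_div_delta hγ₀ hγ₁ x hy hF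
  rw [IntegrableOn, volume_restrict_Omega] at hint
  rw [potential, volume_restrict_Omega, integral_prod_symm _ hint]
  have hbound := norm_setIntegral_le_of_norm_le_const (μ := volume) (s := Ioo c d) (C := K)
    (f := fun s => ∫ r in Ioo a b, F (r, s) / delta γ (x - r) (y - s)) (by simp) fun s hs => by
      have hslice := hK s (Ioo_subset_Icc_self hs)
      rw [intervalIntegral.integral_of_le hab, integral_Ioc_eq_integral_Ioo] at hslice
      simpa only [one_div_mul_eq_div, Real.norm_eq_abs] using hslice
  rwa [Real.volume_real_Ioo_of_le (hy.1.trans hy.2)] at hbound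

end Potential

/-! ### Consistency of the tensor product interpolation -/

section TensorInterp

variable {γ a b c d x y B : ℝ} {Mx My : ℕ} {v : ℝ → ℝ → ℝ}

/-- The piecewise biquadratic interpolant of `v` on the tensor product mesh. -/
noncomputable def tensorInterp (a b c d : ℝ) (Mx My : ℕ) (v : ℝ → ℝ → ℝ) (q : ℝ × ℝ) : ℝ :=
  ∑ k ∈ Finset.range (2 * Mx + 1) ×ˢ Finset.range (2 * My + 1),
    basisFun a b Mx k.1 q.1 * basisFun c d My k.2 q.2 * v (node a b Mx k.1) (node c d My k.2)

theorem tensorInterp_eq_interp_interp (a b c d : ℝ) (Mx My : ℕ) (v : ℝ → ℝ → ℝ) (q : ℝ × ℝ) :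
    tensorInterp a b c d Mx My v q
      = interp c d My (fun s => interp a b Mx (fun r => v r s) q.1) q.2 := by
  simp only [tensorInterp, interp, Finset.sum_product_right, Finset.mul_sum]
  congr! 2
  ring

theorem continuousOn_interp_fst (hh : 0 < meshSize a b Mx)
    (hv : ContinuousOn (Function.uncurry v) (Icc a b ×ˢ Icc c d)) :
    ContinuousOn (Function.uncurry fun r s => interp a b Mx (fun r' => v r' s) r)
      (Icc a b ×ˢ Icc c d) :=
  continuousOn_finsetSum _ fun l hl =>
    ((continuous_basisFun hh l).comp continuous_fst).continuousOn.mul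
      ((hv.uncurry_left _ (node_mem_Icc hh (Finset.mem_range_succ_iff.1 hl))).comp
        continuousOn_snd fun _ hq => hq.2)

theorem continuousOn_interpErr_fst (hh : 0 < meshSize a b Mx)
    (hv : ContinuousOn (Function.uncurry v) (Icc a b ×ˢ Icc c d)) :
    ContinuousOn (fun q : ℝ × ℝ => interpErr a b Mx (fun r => v r q.2) q.1)
      (Icc a b ×ˢ Icc c d) :=
  hv.sub (continuousOn_interp_fst hh hv)

theorem continuousOn_uncurry_flip {s t : Set ℝ} (hv : ContinuousOn (Function.uncurry v) (s ×ˢ t)) :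
    ContinuousOn (Function.uncurry fun y x => v x y) (t ×ˢ s) :=
  hv.comp continuous_swap.continuousOn fun _ hq => ⟨hq.2, hq.1⟩

theorem continuousOn_interpErr_snd (hh : 0 < meshSize c d My)
    (hv : ContinuousOn (Function.uncurry v) (Icc a b ×ˢ Icc c d)) :
    ContinuousOn (fun q : ℝ × ℝ => interpErr c d My (v q.1) q.2) (Icc a b ×ˢ Icc c d) :=
  continuousOn_uncurry_flip (v := fun s r => interpErr c d My (v r) s)
    (continuousOn_interpErr_fst hh (continuousOn_uncurry_flip hv))

theorem hasCubicExpansion_interp_fst (hh : 0 < meshSize a b Mx) (hB : 0 ≤ B)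
    (hv : ∀ r ∈ Icc a b, HasCubicExpansion c d B (v r)) (hx : x ∈ Icc a b) :
    HasCubicExpansion c d (3 * B) fun s => interp a b Mx (fun r => v r s) x :=
  .sum_mul (fun _ hl => hv _ (node_mem_Icc hh (Finset.mem_range_succ_iff.1 hl))) hB
    (sum_abs_basisFun_le hh hx)

theorem abs_potential_interpErr_fst_le (hγ₀ : 0 ≤ γ) (hγ₁ : γ < 1) (hh : 0 < meshSize a b Mx)
    (hv : ContinuousOn (Function.uncurry v) (Icc a b ×ˢ Icc c d))
    (hvx : ∀ s ∈ Icc c d, HasCubicExpansion a b B fun r => v r s)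
    (hx : x ∈ Icc a b) (hy : y ∈ Icc c d) :
    |potential γ a b c d x y fun q => interpErr a b Mx (fun r => v r q.2) q.1|
      ≤ interpConst γ a b * B * meshSize a b Mx ^ (4 - γ) * (d - c) := by
  refine abs_potential_le_of_forall_fst hγ₀ hγ₁ (hx.1.trans hx.2) x hy
    (continuousOn_interpErr_fst hh hv) fun s hs => ?_
  simpa only [delta_abs_left] using
    (isWeaklySingular_one_div_delta hγ₀ (y - s)).abs_integral_abs_sub_mul_interpErr_le hγ₁ hh hx
      (hvx s hs) (hv.uncurry_right s hs)

theorem abs_potential_interpErr_snd_le (hγ₀ : 0 ≤ γ) (hγ₁ : γ < 1) (hh : 0 < meshSize c d My)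
    (hv : ContinuousOn (Function.uncurry v) (Icc a b ×ˢ Icc c d))
    (hvy : ∀ r ∈ Icc a b, HasCubicExpansion c d B (v r)) (hx : x ∈ Icc a b) (hy : y ∈ Icc c d) :
    |potential γ a b c d x y fun q => interpErr c d My (v q.1) q.2|
      ≤ interpConst γ c d * B * meshSize c d My ^ (4 - γ) * (b - a) := by
  rw [← potential_swap]
  exact abs_potential_interpErr_fst_le (v := fun s r => v r s) hγ₀ hγ₁ hh
    (continuousOn_uncurry_flip hv) hvy hy hx

theorem abs_potential_sub_tensorInterp_le (hγ₀ : 0 ≤ γ) (hγ₁ : γ < 1)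
    (hhx : 0 < meshSize a b Mx) (hhy : 0 < meshSize c d My) (hB : 0 ≤ B)
    (hv : ContinuousOn (Function.uncurry v) (Icc a b ×ˢ Icc c d))
    (hvx : ∀ s ∈ Icc c d, HasCubicExpansion a b B fun r => v r s)
    (hvy : ∀ r ∈ Icc a b, HasCubicExpansion c d B (v r)) (hx : x ∈ Icc a b) (hy : y ∈ Icc c d) :
    |potential γ a b c d x y fun q => v q.1 q.2 - tensorInterp a b c d Mx My v q|
      ≤ interpConst γ a b * B * meshSize a b Mx ^ (4 - γ) * (d - c)
        + interpConst γ c d * (3 * B) * meshSize c d My ^ (4 - γ) * (b - a) := by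
  set w : ℝ → ℝ → ℝ := fun r s => interp a b Mx (fun r' => v r' s) r
  have hw : ContinuousOn (Function.uncurry w) (Icc a b ×ˢ Icc c d) :=
    continuousOn_interp_fst hhx hv
  have hsplit (q : ℝ × ℝ) : v q.1 q.2 - tensorInterp a b c d Mx My v q
      = interpErr a b Mx (fun r => v r q.2) q.1 + interpErr c d My (w q.1) q.2 := by
    rw [tensorInterp_eq_interp_interp, interpErr, interpErr, sub_add_sub_cancel]
  simp only [hsplit]
  rw [potential_add hγ₀ hγ₁ x hy (continuousOn_interpErr_fst hhx hv)
    (continuousOn_interpErr_snd hhy hw)]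
  exact (abs_add_le _ _).trans (add_le_add
    (abs_potential_interpErr_fst_le hγ₀ hγ₁ hhx hv hvx hx hy)
    (abs_potential_interpErr_snd_le hγ₀ hγ₁ hhy hw
      (fun r hr => hasCubicExpansion_interp_fst hhx hB hvy hr) hx hy))

end TensorInterp

/-! ### The collocation matrix -/

section Collocation

open scoped Matrix

variable {γ a b c d B : ℝ} {Mx My : ℕ} {v : ℝ → ℝ → ℝ}

theorem constCd_pos (hγ : γ < 1) (hab : a < b) (hcd : c < d) : 0 < constCd γ a b c d := by
  have := sub_pos.2 hγ
  have := sub_pos.2 hab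
  have := sub_pos.2 hcd
  unfold constCd
  positivity

theorem node_succ_mem_Ioo {M : ℕ} (hh : 0 < meshSize a b M) (i : Fin (2 * M - 1)) :
    node a b M (i + 1) ∈ Ioo a b :=
  node_mem_Ioo hh i.1.succ_pos (by omega)

theorem sum_range_eq_add_sum_fin {M : ℕ} (hM : 0 < M) (F : ℕ → ℝ) :
    ∑ l ∈ Finset.range (2 * M + 1), F l = F 0 + F (2 * M) + ∑ i : Fin (2 * M - 1), F (i + 1) := by
  obtain ⟨n, hn⟩ : ∃ n, 2 * M = n + 1 := ⟨2 * M - 1, by omega⟩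
  rw [hn, Finset.sum_range_succ, Finset.sum_range_succ', Nat.add_sub_cancel,
    ← Fin.sum_univ_eq_sum_range fun i => F (i + 1)]
  ring

theorem sum_Icc_one_eq_sum_fin (n : ℕ) (F : ℕ → ℝ) :
    ∑ l ∈ Finset.Icc 1 n, F l = ∑ i : Fin n, F (i + 1) := by
  rw [Fin.sum_univ_eq_sum_range fun i => F (i + 1), Finset.range_eq_Ico, Finset.sum_Ico_add',
    zero_add, Finset.Ico_add_one_right_eq_Icc]

theorem sum_fin_abs_basisFun_le {M : ℕ} (hh : 0 < meshSize a b M) {x : ℝ} (hx : x ∈ Icc a b) :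
    ∑ i : Fin (2 * M - 1), |basisFun a b M (i + 1) x| ≤ 3 := by
  have hsum := sum_abs_basisFun_le hh hx
  rw [sum_range_eq_add_sum_fin (meshSize_pos_iff.1 hh).2] at hsum
  linarith [abs_nonneg (basisFun a b M 0 x), abs_nonneg (basisFun a b M (2 * M) x)]

theorem continuous_basisFun_mul_basisFun (hhx : 0 < meshSize a b Mx) (hhy : 0 < meshSize c d My)
    (l r : ℕ) : Continuous fun q : ℝ × ℝ => basisFun a b Mx l q.1 * basisFun c d My r q.2 :=
  ((continuous_basisFun hhx l).comp continuous_fst).mul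
    ((continuous_basisFun hhy r).comp continuous_snd)

theorem matG_mulVec_apply (hγ₀ : 0 ≤ γ) (hγ₁ : γ < 1) (hhx : 0 < meshSize a b Mx)
    (hhy : 0 < meshSize c d My) (V : Index Mx My → ℝ) (p : Index Mx My) :
    (matG γ a b c d Mx My *ᵥ V) p
      = potential γ a b c d (node a b Mx (p.1 + 1)) (node c d My (p.2 + 1)) fun q =>
        ∑ k, basisFun a b Mx (k.1 + 1) q.1 * basisFun c d My (k.2 + 1) q.2 * V k :=
  (potential_sum_mul hγ₀ hγ₁ _ (Ioo_subset_Icc_self (node_succ_mem_Ioo hhy p.2))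
    (F := fun (k : Index Mx My) q =>
      basisFun a b Mx (k.1 + 1) q.1 * basisFun c d My (k.2 + 1) q.2)
    (fun _ _ => (continuous_basisFun_mul_basisFun hhx hhy _ _).continuousOn) V).symm

theorem abs_sum_basisFun_mul_basisFun_mul_le (hhx : 0 < meshSize a b Mx)
    (hhy : 0 < meshSize c d My) (V : Index Mx My → ℝ) {q : ℝ × ℝ}
    (hq : q ∈ Icc a b ×ˢ Icc c d) :
    |∑ k, basisFun a b Mx (k.1 + 1) q.1 * basisFun c d My (k.2 + 1) q.2 * V k| ≤ 9 * ‖V‖ :=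
  calc |∑ k, basisFun a b Mx (k.1 + 1) q.1 * basisFun c d My (k.2 + 1) q.2 * V k|
      ≤ ∑ k : Index Mx My,
          |basisFun a b Mx (k.1 + 1) q.1| * |basisFun c d My (k.2 + 1) q.2| * ‖V‖ := by
        refine (Finset.abs_sum_le_sum_abs _ _).trans (Finset.sum_le_sum fun k _ => ?_)
        rw [abs_mul, abs_mul]
        exact mul_le_mul_of_nonneg_left (norm_le_pi_norm V k) (by positivity)
    _ = (∑ i : Fin (2 * Mx - 1), |basisFun a b Mx (i + 1) q.1|)
          * (∑ j : Fin (2 * My - 1), |basisFun c d My (j + 1) q.2|) * ‖V‖ := by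
        rw [← Finset.sum_mul, Finset.sum_mul_sum, Fintype.sum_prod_type]
    _ ≤ 3 * 3 * ‖V‖ := by
        gcongr
        · exact sum_fin_abs_basisFun_le hhx hq.1
        · exact sum_fin_abs_basisFun_le hhy hq.2
    _ = 9 * ‖V‖ := by norm_num

theorem norm_matG_mulVec_le (hγ₀ : 0 ≤ γ) (hγ₁ : γ < 1) (hhx : 0 < meshSize a b Mx)
    (hhy : 0 < meshSize c d My) (V : Index Mx My → ℝ) :
    ‖matG γ a b c d Mx My *ᵥ V‖ ≤ 9 * constCd γ a b c d * ‖V‖ := by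
  have hab := (meshSize_pos_iff.1 hhx).1
  have hC := constCd_pos hγ₁ hab (meshSize_pos_iff.1 hhy).1
  refine (pi_norm_le_iff_of_nonneg (by positivity)).2 fun p => ?_
  rw [matG_mulVec_apply hγ₀ hγ₁ hhx hhy, mul_right_comm]
  exact abs_potential_le hγ₀ hγ₁ hab.le _ (Ioo_subset_Icc_self (node_succ_mem_Ioo hhy p.2))
    fun q hq => abs_sum_basisFun_mul_basisFun_mul_le hhx hhy V hq

theorem norm_matD_mulVec_le (hγ₀ : 0 ≤ γ) (hγ₁ : γ < 1) (hab : a < b)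
    (hhy : 0 < meshSize c d My) (V : Index Mx My → ℝ) :
    ‖matD γ a b c d Mx My *ᵥ V‖ ≤ constCd γ a b c d * ‖V‖ := by
  have hC := constCd_pos hγ₁ hab (meshSize_pos_iff.1 hhy).1
  refine (pi_norm_le_iff_of_nonneg (by positivity)).2 fun p => ?_
  have hdiag : |diagCoeff γ a b c d Mx My (p.1 + 1) (p.2 + 1)| ≤ 1 * constCd γ a b c d :=
    abs_potential_le hγ₀ hγ₁ hab.le _ (Ioo_subset_Icc_self (node_succ_mem_Ioo hhy p.2))
      fun _ _ => abs_one.le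
  rw [matD, Matrix.mulVec_diagonal, norm_mul]
  exact mul_le_mul (hdiag.trans_eq (one_mul _)) (norm_le_pi_norm V p) (norm_nonneg _) hC.le

theorem norm_matA_mulVec_le (hγ₀ : 0 ≤ γ) (hγ₁ : γ < 1) (hhx : 0 < meshSize a b Mx)
    (hhy : 0 < meshSize c d My) (V : Index Mx My → ℝ) :
    ‖matA γ a b c d Mx My *ᵥ V‖ ≤ 10 * constCd γ a b c d * ‖V‖ := by
  rw [matA, Matrix.sub_mulVec]
  linarith [norm_sub_le (matD γ a b c d Mx My *ᵥ V) (matG γ a b c d Mx My *ᵥ V),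
    norm_matD_mulVec_le (Mx := Mx) hγ₀ hγ₁ (meshSize_pos_iff.1 hhx).1 hhy V,
    norm_matG_mulVec_le hγ₀ hγ₁ hhx hhy V]

theorem matG_mulVec_gridFun_add_boundaryVec (hMx : 0 < Mx) (hMy : 0 < My) (v : ℝ → ℝ → ℝ)
    (p : Index Mx My) :
    (matG γ a b c d Mx My *ᵥ gridFun a b c d Mx My v + boundaryVec γ a b c d Mx My v) p
      = ∑ k ∈ Finset.range (2 * Mx + 1) ×ˢ Finset.range (2 * My + 1),
        basisCoeff γ a b c d Mx My (p.1 + 1) (p.2 + 1) k.1 k.2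
          * v (node a b Mx k.1) (node c d My k.2) := by
  rw [Finset.sum_product, sum_range_eq_add_sum_fin hMx, Pi.add_apply, boundaryVec]
  simp only [sum_range_eq_add_sum_fin hMy, ← Nat.range_succ_eq_Icc_zero, sum_Icc_one_eq_sum_fin,
    Matrix.mulVec, dotProduct, matG, Matrix.of_apply, gridFun, Fintype.sum_prod_type,
    Finset.sum_add_distrib]
  ring

theorem matG_mulVec_gridFun_add_boundaryVec_eq_potential (hγ₀ : 0 ≤ γ) (hγ₁ : γ < 1)
    (hhx : 0 < meshSize a b Mx) (hhy : 0 < meshSize c d My) (v : ℝ → ℝ → ℝ) (p : Index Mx My) :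
    (matG γ a b c d Mx My *ᵥ gridFun a b c d Mx My v + boundaryVec γ a b c d Mx My v) p
      = potential γ a b c d (node a b Mx (p.1 + 1)) (node c d My (p.2 + 1))
        (tensorInterp a b c d Mx My v) :=
  (matG_mulVec_gridFun_add_boundaryVec (meshSize_pos_iff.1 hhx).2 (meshSize_pos_iff.1 hhy).2 v
    p).trans (potential_sum_mul hγ₀ hγ₁ _ (Ioo_subset_Icc_self (node_succ_mem_Ioo hhy p.2))
      (F := fun (k : ℕ × ℕ) q => basisFun a b Mx k.1 q.1 * basisFun c d My k.2 q.2)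
      (fun _ _ => (continuous_basisFun_mul_basisFun hhx hhy _ _).continuousOn) _).symm

/-- The nonlocal diffusion operator `v ↦ ∫_Ω (v - v(q)) / δ dq` of the equation. -/
noncomputable def nonlocalOp (γ a b c d : ℝ) (v : ℝ → ℝ → ℝ) (x y : ℝ) : ℝ :=
  potential γ a b c d x y fun q => v x y - v q.1 q.2

theorem matA_mulVec_gridFun_sub_nonlocalOp (hγ₀ : 0 ≤ γ) (hγ₁ : γ < 1)
    (hhx : 0 < meshSize a b Mx) (hhy : 0 < meshSize c d My)
    (hv : ContinuousOn (Function.uncurry v) (Icc a b ×ˢ Icc c d)) (p : Index Mx My) :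
    (matA γ a b c d Mx My *ᵥ gridFun a b c d Mx My v - boundaryVec γ a b c d Mx My v
        - gridFun a b c d Mx My (nonlocalOp γ a b c d v)) p
      = potential γ a b c d (node a b Mx (p.1 + 1)) (node c d My (p.2 + 1))
        fun q => v q.1 q.2 - tensorInterp a b c d Mx My v q := by
  have hy : node c d My (p.2 + 1) ∈ Icc c d := Ioo_subset_Icc_self (node_succ_mem_Ioo hhy p.2)
  have hinterp : Continuous (tensorInterp a b c d Mx My v) :=
    continuous_finsetSum _ fun _ _ =>
      (continuous_basisFun_mul_basisFun hhx hhy _ _).mul_const _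
  have hdiag : (matD γ a b c d Mx My *ᵥ gridFun a b c d Mx My v) p
      = potential γ a b c d (node a b Mx (p.1 + 1)) (node c d My (p.2 + 1))
        fun _ => v (node a b Mx (p.1 + 1)) (node c d My (p.2 + 1)) := by
    rw [matD, Matrix.mulVec_diagonal, diagCoeff, ← integral_mul_const]
    simp only [potential, one_div_mul_eq_div, gridFun]
  have hsplit := matG_mulVec_gridFun_add_boundaryVec_eq_potential hγ₀ hγ₁ hhx hhy v p
  simp only [Pi.add_apply] at hsplit
  replace hv : ContinuousOn (fun q : ℝ × ℝ => v q.1 q.2) (Icc a b ×ˢ Icc c d) := hv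
  rw [potential_sub hγ₀ hγ₁ _ hy hv hinterp.continuousOn, ← hsplit, matA, Matrix.sub_mulVec]
  simp only [Pi.sub_apply, hdiag, gridFun, nonlocalOp]
  rw [potential_sub hγ₀ hγ₁ _ hy continuousOn_const hv]
  ring

theorem norm_matA_mulVec_gridFun_sub_nonlocalOp_le (hγ₀ : 0 ≤ γ) (hγ₁ : γ < 1)
    (hhx : 0 < meshSize a b Mx) (hhy : 0 < meshSize c d My)
    (hv : ContinuousOn (Function.uncurry v) (Icc a b ×ˢ Icc c d))
    (hvx : ∀ s ∈ Icc c d, HasCubicExpansion a b B fun r => v r s)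
    (hvy : ∀ r ∈ Icc a b, HasCubicExpansion c d B (v r)) :
    ‖matA γ a b c d Mx My *ᵥ gridFun a b c d Mx My v - boundaryVec γ a b c d Mx My v
        - gridFun a b c d Mx My (nonlocalOp γ a b c d v)‖
      ≤ interpConst γ a b * B * meshSize a b Mx ^ (4 - γ) * (d - c)
        + interpConst γ c d * (3 * B) * meshSize c d My ^ (4 - γ) * (b - a) := by
  have hbound {x y : ℝ} (hx : x ∈ Icc a b) (hy : y ∈ Icc c d) :=
    abs_potential_sub_tensorInterp_le hγ₀ hγ₁ hhx hhy
      ((hvy x hx).nonneg (hy.1.trans hy.2)) hv hvx hvy hx hy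
  have hab := (meshSize_pos_iff.1 hhx).1.le
  have hcd := (meshSize_pos_iff.1 hhy).1.le
  refine (pi_norm_le_iff_of_nonneg ((abs_nonneg _).trans
    (hbound (left_mem_Icc.2 hab) (left_mem_Icc.2 hcd)))).2 fun p => ?_
  rw [matA_mulVec_gridFun_sub_nonlocalOp hγ₀ hγ₁ hhx hhy hv]
  exact hbound (Ioo_subset_Icc_self (node_succ_mem_Ioo hhx p.1))
    (Ioo_subset_Icc_self (node_succ_mem_Ioo hhy p.2))

end Collocation

/-! ### The Crank–Nicolson scheme -/

section CrankNicolson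

variable {L τ R : ℝ}

theorem bijective_add_smul {E : Type*} [NormedAddCommGroup E] [NormedSpace ℝ E]
    [FiniteDimensional ℝ E] {A : E →ₗ[ℝ] E} (hA : ∀ v, ‖A v‖ ≤ L * ‖v‖) (hτ : 0 ≤ τ)
    (hτL : τ * L < 1) : Function.Bijective fun v => v + τ • A v := by
  have hinj : Function.Injective (LinearMap.id + τ • A : E →ₗ[ℝ] E) := by
    refine (injective_iff_map_eq_zero _).2 fun v hv => ?_
    replace hv : v = -(τ • A v) := eq_neg_of_add_eq_zero_left hv
    have hnorm : ‖v‖ ≤ τ * L * ‖v‖ :=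
      calc ‖v‖ = τ * ‖A v‖ := by
            conv_lhs => rw [hv, norm_neg, norm_smul, Real.norm_of_nonneg hτ]
        _ ≤ τ * (L * ‖v‖) := mul_le_mul_of_nonneg_left (hA v) hτ
        _ = τ * L * ‖v‖ := (mul_assoc _ _ _).symm
    exact norm_le_zero_iff.1 (by nlinarith [norm_nonneg v])
  exact ⟨hinj, LinearMap.injective_iff_surjective.1 hinj⟩

theorem existsUnique_implicit_recursion {X : Type*} {N : ℕ} (x₀ : X) {Φ : X → X}
    (hΦ : Function.Bijective Φ) (Ψ : Fin N → X → X) :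
    ∃! U : Fin (N + 1) → X, U 0 = x₀ ∧ ∀ k : Fin N, Φ (U k.succ) = Ψ k (U k.castSucc) := by
  obtain ⟨Θ, hΘ⟩ := hΦ.2.hasRightInverse
  refine ⟨fun k => Fin.induction (motive := fun _ => X) x₀ (fun k x => Θ (Ψ k x)) k,
    ⟨rfl, fun k => hΘ (Ψ k _)⟩, ?_⟩
  rintro U ⟨hU₀, hU⟩
  funext k
  induction k using Fin.induction with
  | zero => exact hU₀
  | succ k ih => exact hΦ.1 (by rw [hU k, ih, Fin.induction_succ, hΘ])

theorem le_exp_mul_add_of_implicit_step {x z : ℝ} (hL : 0 ≤ L) (hτ : 0 ≤ τ) (hτL : τ * L ≤ 1)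
    (hR : 0 ≤ R) (hx : 0 ≤ x) (hstep : z ≤ x + τ / 2 * (L * (x + z)) + τ * R) :
    z ≤ Real.exp (2 * L * τ) * x + 2 * R * τ := by
  have hτL₀ : 0 ≤ τ * L := by positivity
  have hτR : 0 ≤ τ * R := by positivity
  have hlinear : z ≤ (1 + 2 * L * τ) * x + 2 * R * τ := by
    refine le_of_mul_le_mul_left (a := 1 - τ * L / 2) ?_ (by linarith)
    nlinarith [mul_nonneg (mul_nonneg hτL₀ (sub_nonneg.2 hτL)) hx,
      mul_nonneg (sub_nonneg.2 hτL) hτR]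
  refine hlinear.trans ?_
  gcongr
  linarith [Real.add_one_le_exp (2 * L * τ)]

theorem norm_le_of_crankNicolson {E : Type*} [NormedAddCommGroup E] [NormedSpace ℝ E] {N : ℕ}
    {A : E → E} {e : Fin (N + 1) → E} (hA : ∀ v, ‖A v‖ ≤ L * ‖v‖) (hL : 0 ≤ L) (hτ : 0 ≤ τ)
    (hτL : τ * L ≤ 1) (hR : 0 ≤ R) (he₀ : e 0 = 0)
    (hstep : ∀ k : Fin N,
      ‖e k.succ - e k.castSucc + (τ / 2) • A (e k.castSucc + e k.succ)‖ ≤ τ * R)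
    (k : Fin (N + 1)) : ‖e k‖ ≤ Real.exp (2 * L * (k * τ)) * (2 * R * (k * τ)) := by
  induction k using Fin.induction with
  | zero => simp [he₀]
  | succ k ih =>
    simp only [Fin.val_castSucc, Fin.val_succ, Nat.cast_succ] at ih ⊢
    set r := e k.succ - e k.castSucc + (τ / 2) • A (e k.castSucc + e k.succ) with hr
    have hAe : ‖(τ / 2) • A (e k.castSucc + e k.succ)‖
        ≤ τ / 2 * (L * (‖e k.castSucc‖ + ‖e k.succ‖)) := by
      rw [norm_smul, Real.norm_of_nonneg (by positivity)]
      gcongr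
      exact (hA _).trans (mul_le_mul_of_nonneg_left (norm_add_le _ _) hL)
    have hsplit : e k.succ = e k.castSucc - (τ / 2) • A (e k.castSucc + e k.succ) + r := by
      rw [hr]
      abel
    have hnorm : ‖e k.succ‖ ≤ ‖e k.castSucc‖ + τ / 2 * (L * (‖e k.castSucc‖ + ‖e k.succ‖))
        + τ * R := by
      conv_lhs => rw [hsplit]
      exact (norm_add_le _ _).trans
        (add_le_add ((norm_sub_le _ _).trans (add_le_add_right hAe _)) (hstep k))
    have hexp : 1 ≤ Real.exp (2 * L * ((k + 1) * τ)) := Real.one_le_exp (by positivity)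
    have hexp_add : Real.exp (2 * L * ((k + 1) * τ))
        = Real.exp (2 * L * τ) * Real.exp (2 * L * (k * τ)) := by
      rw [← Real.exp_add]
      congr 1
      ring
    calc ‖e k.succ‖ ≤ Real.exp (2 * L * τ) * ‖e k.castSucc‖ + 2 * R * τ :=
          le_exp_mul_add_of_implicit_step hL hτ hτL hR (norm_nonneg _) hnorm
      _ ≤ Real.exp (2 * L * τ) * (Real.exp (2 * L * (k * τ)) * (2 * R * (k * τ)))
          + Real.exp (2 * L * ((k + 1) * τ)) * (2 * R * τ) :=
        add_le_add (mul_le_mul_of_nonneg_left ih (Real.exp_pos _).le)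
          (le_mul_of_one_le_left (by positivity) hexp)
      _ = Real.exp (2 * L * ((k + 1) * τ)) * (2 * R * ((k + 1) * τ)) := by
        rw [hexp_add]
        ring

end CrankNicolson

/-! ### The truncation error -/

section Truncation

open scoped Matrix

variable {γ a b c d T B τ t : ℝ} {Mx My : ℕ} {f g u : ℝ → ℝ → ℝ → ℝ} {u₀ v w : ℝ → ℝ → ℝ}

/-- Regularity with respect to each variable separately: `u` is continuous in space, and its pure
derivatives of order at most `4` in either space variable and at most `3` in time are bounded
by `B`. -/
structure IsSeparatelySmooth (a b c d T B : ℝ) (u : ℝ → ℝ → ℝ → ℝ) : Prop where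
  continuousOn : ∀ t ∈ Icc 0 T,
    ContinuousOn (Function.uncurry fun x y => u x y t) (Icc a b ×ˢ Icc c d)
  fst : ∀ t ∈ Icc 0 T, ∀ y ∈ Icc c d, HasBoundedDerivs 4 B (fun x => u x y t) (Icc a b)
  snd : ∀ t ∈ Icc 0 T, ∀ x ∈ Icc a b, HasBoundedDerivs 4 B (fun y => u x y t) (Icc c d)
  time : ∀ x ∈ Icc a b, ∀ y ∈ Icc c d, HasBoundedDerivs 3 B (u x y) (Icc 0 T)

theorem mem_frontier_Omega_iff (hab : a < b) (hcd : c < d) {x y : ℝ} :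
    (x, y) ∈ frontier (Omega a b c d) ↔
      x ∈ Icc a b ∧ y ∈ Icc c d ∧ ¬(x ∈ Ioo a b ∧ y ∈ Ioo c d) := by
  have hopen : IsOpen (Omega a b c d) := isOpen_Ioo.prod isOpen_Ioo
  rw [hopen.frontier_eq, Omega, closure_prod_eq, closure_Ioo hab.ne, closure_Ioo hcd.ne, mem_sdiff,
    mem_prod, mem_prod, and_assoc]

theorem boundaryVec_congr (hhx : 0 < meshSize a b Mx) (hhy : 0 < meshSize c d My)
    (h : ∀ x y, (x, y) ∈ frontier (Omega a b c d) → v x y = w x y) :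
    boundaryVec γ a b c d Mx My v = boundaryVec γ a b c d Mx My w := by
  obtain ⟨hab, hMx⟩ := meshSize_pos_iff.1 hhx
  obtain ⟨hcd, hMy⟩ := meshSize_pos_iff.1 hhy
  have hnode {l r : ℕ} (hl : l ≤ 2 * Mx) (hr : r ≤ 2 * My)
      (hlr : l = 0 ∨ l = 2 * Mx ∨ r = 0 ∨ r = 2 * My) :
      v (node a b Mx l) (node c d My r) = w (node a b Mx l) (node c d My r) := by
    refine h _ _ ((mem_frontier_Omega_iff hab hcd).2
      ⟨node_mem_Icc hhx hl, node_mem_Icc hhy hr, fun ⟨hx, hy⟩ => ?_⟩)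
    rcases hlr with rfl | rfl | rfl | rfl <;>
      simp [node_zero, node_two_mul hMx, node_two_mul hMy] at hx hy
  funext p
  refine congrArg₂ (· + ·) (congrArg₂ (· + ·) (congrArg₂ (· + ·) ?_ ?_) ?_) ?_ <;>
    refine Finset.sum_congr rfl fun k hk => congrArg _ (hnode ?_ ?_ ?_) <;>
    grind

/-- The residual of `u` in the step of the scheme from time `t` to time `t + τ`. -/
noncomputable def truncationError (γ a b c d : ℝ) (f g u : ℝ → ℝ → ℝ → ℝ) (Mx My : ℕ)
    (τ t : ℝ) : Index Mx My → ℝ :=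
  let v s := gridFun a b c d Mx My fun x y => u x y s
  v (t + τ) - v t + (τ / 2) • (matA γ a b c d Mx My *ᵥ (v t + v (t + τ)))
    - τ • gridFun a b c d Mx My (fun x y => f x y (t + τ / 2))
    - τ • boundaryVec γ a b c d Mx My fun x y => g x y (t + τ / 2)

theorem IsExactSolution.gridFun_source (hu : IsExactSolution γ a b c d T f g u₀ u)
    (hhx : 0 < meshSize a b Mx) (hhy : 0 < meshSize c d My) (ht : t ∈ Ioc 0 T) :
    gridFun a b c d Mx My (fun x y => f x y t)
      = gridFun a b c d Mx My (fun x y => derivWithin (u x y) (Icc 0 T) t)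
        + gridFun a b c d Mx My (nonlocalOp γ a b c d fun x y => u x y t) := by
  funext p
  have hderiv := (hu.equation _ _ t
    ⟨node_succ_mem_Ioo hhx p.1, node_succ_mem_Ioo hhy p.2⟩ ht).derivWithin
    (uniqueDiffOn_Icc (ht.1.trans_le ht.2) t (Ioc_subset_Icc_self ht))
  exact (sub_eq_iff_eq_add.1 hderiv.symm)

theorem IsExactSolution.truncationError_eq (hu : IsExactSolution γ a b c d T f g u₀ u)
    (hhx : 0 < meshSize a b Mx) (hhy : 0 < meshSize c d My) (ht : t + τ / 2 ∈ Ioc 0 T) :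
    truncationError γ a b c d f g u Mx My τ t
      = gridFun a b c d Mx My (fun x y =>
          u x y (t + τ) - u x y t - τ * derivWithin (u x y) (Icc 0 T) (t + τ / 2))
        + τ • (matA γ a b c d Mx My *ᵥ gridFun a b c d Mx My fun x y =>
          (u x y t + u x y (t + τ)) / 2 - u x y (t + τ / 2))
        + τ • (matA γ a b c d Mx My *ᵥ gridFun a b c d Mx My (fun x y => u x y (t + τ / 2))
          - boundaryVec γ a b c d Mx My (fun x y => u x y (t + τ / 2))
          - gridFun a b c d Mx My (nonlocalOp γ a b c d fun x y => u x y (t + τ / 2))) := by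
  have hboundary := boundaryVec_congr (γ := γ) hhx hhy fun x y hxy => hu.boundary x y _ hxy ht
  have haverage : (gridFun a b c d Mx My fun x y =>
        (u x y t + u x y (t + τ)) / 2 - u x y (t + τ / 2))
      = (1 / 2 : ℝ) • (gridFun a b c d Mx My (fun x y => u x y t)
        + gridFun a b c d Mx My fun x y => u x y (t + τ))
        - gridFun a b c d Mx My fun x y => u x y (t + τ / 2) := by
    funext p
    simp only [gridFun, Pi.sub_apply, Pi.smul_apply, Pi.add_apply, smul_eq_mul]
    ring
  have htime : (gridFun a b c d Mx My fun x y =>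
        u x y (t + τ) - u x y t - τ * derivWithin (u x y) (Icc 0 T) (t + τ / 2))
      = gridFun a b c d Mx My (fun x y => u x y (t + τ))
        - gridFun a b c d Mx My (fun x y => u x y t)
        - τ • gridFun a b c d Mx My fun x y => derivWithin (u x y) (Icc 0 T) (t + τ / 2) := rfl
  simp only [truncationError, hu.gridFun_source hhx hhy ht, ← hboundary, haverage, htime,
    Matrix.mulVec_sub, Matrix.mulVec_smul]
  module

theorem norm_gridFun_le {K : ℝ} (hhx : 0 < meshSize a b Mx) (hhy : 0 < meshSize c d My)
    (hv : ∀ x ∈ Icc a b, ∀ y ∈ Icc c d, |v x y| ≤ K) : ‖gridFun a b c d Mx My v‖ ≤ K :=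
  (pi_norm_le_iff_of_nonneg ((abs_nonneg _).trans
    (hv a (left_mem_Icc.2 (meshSize_pos_iff.1 hhx).1.le) c
      (left_mem_Icc.2 (meshSize_pos_iff.1 hhy).1.le)))).2 fun p =>
      hv _ (Ioo_subset_Icc_self (node_succ_mem_Ioo hhx p.1)) _
        (Ioo_subset_Icc_self (node_succ_mem_Ioo hhy p.2))

theorem IsExactSolution.norm_truncationError_le (hγ₀ : 0 ≤ γ) (hγ₁ : γ < 1)
    (hu : IsExactSolution γ a b c d T f g u₀ u) (hreg : IsSeparatelySmooth a b c d T B u)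
    (hhx : 0 < meshSize a b Mx) (hhy : 0 < meshSize c d My) (ht : 0 ≤ t) (hτ : 0 < τ)
    (htτ : t + τ ≤ T) :
    ‖truncationError γ a b c d f g u Mx My τ t‖
      ≤ τ * (B * (1 + 10 * constCd γ a b c d) * τ ^ 2
        + (interpConst γ a b * B * meshSize a b Mx ^ (4 - γ) * (d - c)
          + interpConst γ c d * (3 * B) * meshSize c d My ^ (4 - γ) * (b - a))) := by
  have hC := constCd_pos hγ₁ (meshSize_pos_iff.1 hhx).1 (meshSize_pos_iff.1 hhy).1
  have htI : t ∈ Icc 0 T := ⟨ht, by linarith⟩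
  have hmid : t + τ / 2 ∈ Ioc 0 T := ⟨by linarith, by linarith⟩
  have hmidI := Ioc_subset_Icc_self hmid
  have htime : ‖gridFun a b c d Mx My fun x y =>
      u x y (t + τ) - u x y t - τ * derivWithin (u x y) (Icc 0 T) (t + τ / 2)‖ ≤ B * τ ^ 3 :=
    norm_gridFun_le hhx hhy fun x hx y hy =>
      (hreg.time x hx y hy).abs_sub_sub_midpoint_derivWithin_le hτ htI htτ
  have haverage : ‖gridFun a b c d Mx My fun x y =>
      (u x y t + u x y (t + τ)) / 2 - u x y (t + τ / 2)‖ ≤ B * τ ^ 2 :=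
    norm_gridFun_le hhx hhy fun x hx y hy =>
      ((hreg.time x hx y hy).mono_order (by norm_num)).abs_average_sub_midpoint_le hτ.le htI htτ
  have hspace := norm_matA_mulVec_gridFun_sub_nonlocalOp_le hγ₀ hγ₁ hhx hhy
    (hreg.continuousOn _ hmidI) (fun y hy => (hreg.fst _ hmidI y hy).hasCubicExpansion)
    fun x hx => (hreg.snd _ hmidI x hx).hasCubicExpansion
  rw [hu.truncationError_eq hhx hhy hmid]
  refine (norm_add₃_le.trans (add_le_add_three htime
    (norm_smul_le _ _) (norm_smul_le _ _))).trans ?_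
  rw [Real.norm_of_nonneg hτ.le]
  calc _ ≤ B * τ ^ 3 + τ * (10 * constCd γ a b c d * (B * τ ^ 2))
        + τ * (interpConst γ a b * B * meshSize a b Mx ^ (4 - γ) * (d - c)
          + interpConst γ c d * (3 * B) * meshSize c d My ^ (4 - γ) * (b - a)) := by
        gcongr
        exact (norm_matA_mulVec_le hγ₀ hγ₁ hhx hhy _).trans (by gcongr)
    _ = _ := by ring

end Truncation

/-! ### Unique solvability and error bound -/

section Scheme

open scoped Matrix

variable {γ a b c d T τ R : ℝ} {Mx My N : ℕ} {f g u : ℝ → ℝ → ℝ → ℝ} {u₀ : ℝ → ℝ → ℝ}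
  {U : Fin (N + 1) → Index Mx My → ℝ}

theorem existsUnique_isSchemeSolution (hγ₀ : 0 ≤ γ) (hγ₁ : γ < 1) (hhx : 0 < meshSize a b Mx)
    (hhy : 0 < meshSize c d My) (f g : ℝ → ℝ → ℝ → ℝ) (u₀ : ℝ → ℝ → ℝ) (N : ℕ) (hτ : 0 ≤ τ)
    (hτC : τ * (10 * constCd γ a b c d) ≤ 1) :
    ∃! U : Fin (N + 1) → Index Mx My → ℝ, IsSchemeSolution γ a b c d f g u₀ Mx My N τ U := by
  have hbijective : Function.Bijective (1 + (τ / 2) • matA γ a b c d Mx My).mulVec := by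
    convert bijective_add_smul (A := (matA γ a b c d Mx My).mulVecLin) (τ := τ / 2)
      (norm_matA_mulVec_le hγ₀ hγ₁ hhx hhy) (by linarith) (by linarith) using 2 with V
    rw [Matrix.add_mulVec, Matrix.one_mulVec, Matrix.smul_mulVec, Matrix.mulVecLin_apply]
  obtain ⟨U, ⟨hstart, hstep⟩, hunique⟩ := existsUnique_implicit_recursion
    (gridFun a b c d Mx My u₀) hbijective fun (k : Fin N) V =>
      (1 - (τ / 2) • matA γ a b c d Mx My) *ᵥ V
      + τ • gridFun a b c d Mx My (fun x y => f x y (((k : ℝ) + 1 / 2) * τ))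
      + τ • boundaryVec γ a b c d Mx My (fun x y => g x y (((k : ℝ) + 1 / 2) * τ))
  exact ⟨U, ⟨hstart, hstep⟩, fun V hV => hunique V ⟨hV.start, hV.step⟩⟩

/-- The nodal error of a discrete solution at the `k`-th time level. -/
noncomputable def nodalError (a b c d : ℝ) (u : ℝ → ℝ → ℝ → ℝ) (τ : ℝ)
    (U : Fin (N + 1) → Index Mx My → ℝ) (k : Fin (N + 1)) : Index Mx My → ℝ :=
  gridFun a b c d Mx My (fun x y => u x y (k * τ)) - U k

theorem IsSchemeSolution.nodalError_step (hU : IsSchemeSolution γ a b c d f g u₀ Mx My N τ U)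
    (u : ℝ → ℝ → ℝ → ℝ) (k : Fin N) :
    nodalError a b c d u τ U k.succ - nodalError a b c d u τ U k.castSucc
        + (τ / 2) • (matA γ a b c d Mx My
          *ᵥ (nodalError a b c d u τ U k.castSucc + nodalError a b c d u τ U k.succ))
      = truncationError γ a b c d f g u Mx My τ (k * τ) := by
  have hstep := hU.step k
  rw [Matrix.add_mulVec, Matrix.sub_mulVec, Matrix.one_mulVec, Matrix.one_mulVec,
    Matrix.smul_mulVec, Matrix.smul_mulVec] at hstep
  have hend : ((k : ℝ) + 1) * τ = k * τ + τ := by ring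
  have hmid : ((k : ℝ) + 1 / 2) * τ = k * τ + τ / 2 := by ring
  rw [hmid] at hstep
  simp only [nodalError, truncationError, Fin.val_succ, Fin.val_castSucc, Nat.cast_succ, hend,
    Matrix.mulVec_add, Matrix.mulVec_sub]
  linear_combination (norm := module) -hstep

theorem IsSchemeSolution.norm_nodalError_le (hγ₀ : 0 ≤ γ) (hγ₁ : γ < 1)
    (hhx : 0 < meshSize a b Mx) (hhy : 0 < meshSize c d My) (hτ : 0 ≤ τ)
    (hτC : τ * (10 * constCd γ a b c d) ≤ 1) (hR : 0 ≤ R)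
    (hU : IsSchemeSolution γ a b c d f g u₀ Mx My N τ U)
    (hu₀ : ∀ x y, (x, y) ∈ Omega a b c d → u x y 0 = u₀ x y)
    (hres : ∀ k : Fin N, ‖truncationError γ a b c d f g u Mx My τ (k * τ)‖ ≤ τ * R)
    (k : Fin (N + 1)) :
    ‖nodalError a b c d u τ U k‖
      ≤ Real.exp (2 * (10 * constCd γ a b c d) * (k * τ)) * (2 * R * (k * τ)) := by
  have hC := constCd_pos hγ₁ (meshSize_pos_iff.1 hhx).1 (meshSize_pos_iff.1 hhy).1
  refine norm_le_of_crankNicolson (norm_matA_mulVec_le hγ₀ hγ₁ hhx hhy) (by positivity) hτ hτC hR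
    ?_ (fun k => by rw [hU.nodalError_step]; exact hres k) k
  funext p
  simp only [nodalError, hU.start, gridFun, Fin.val_zero, Nat.cast_zero, zero_mul, Pi.sub_apply,
    Pi.zero_apply]
  exact sub_eq_zero.2 (hu₀ _ _ ⟨node_succ_mem_Ioo hhx p.1, node_succ_mem_Ioo hhy p.2⟩)

end Scheme

/-! ### Slices of a smooth function -/

section Slices

variable {a b c d T B : ℝ} {n : ℕ}

theorem hasBoundedDerivs_comp_continuousAffineMap {E : Type*} [NormedAddCommGroup E]
    [NormedSpace ℝ E] {F : E → ℝ} {S : Set E} {I : Set ℝ} {g : ℝ →ᴬ[ℝ] E}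
    (hF : ContDiffOn ℝ n F S) (hS : UniqueDiffOn ℝ S)
    (hB : ∀ z ∈ S, ∀ m ≤ n, ‖iteratedFDerivWithin ℝ m F S z‖ ≤ B) (hI : UniqueDiffOn ℝ I)
    (hg : ‖g.contLinear‖ ≤ 1) (hgI : MapsTo g I S) : HasBoundedDerivs n B (F ∘ g) I := by
  have htaylor := ((hF.ftaylorSeriesWithin hS).comp_continuousAffineMap g).mono hgI
  refine ⟨hF.comp g.contDiff.contDiffOn hgI, fun m hm x hx => ?_⟩
  rw [← Real.norm_eq_abs, ← norm_iteratedFDerivWithin_eq_norm_iteratedDerivWithin,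
    ← htaylor.eq_iteratedFDerivWithin_of_uniqueDiffOn (by exact_mod_cast hm) hI hx]
  refine (ContinuousMultilinearMap.norm_compContinuousLinearMap_le _ _).trans ?_
  rw [Finset.prod_const]
  exact (mul_le_of_le_one_right (norm_nonneg _) (pow_le_one₀ (norm_nonneg _) hg)).trans
    (hB _ (hgI hx) m hm)

theorem hasBoundedDerivs_slice_fst {F : ℝ × ℝ → ℝ} (hab : a < b) (hcd : c < d)
    (hF : ContDiffOn ℝ n F (Icc a b ×ˢ Icc c d))
    (hB : ∀ z ∈ Icc a b ×ˢ Icc c d, ∀ m ≤ n,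
      ‖iteratedFDerivWithin ℝ m F (Icc a b ×ˢ Icc c d) z‖ ≤ B) {y : ℝ} (hy : y ∈ Icc c d) :
    HasBoundedDerivs n B (fun x => F (x, y)) (Icc a b) :=
  hasBoundedDerivs_comp_continuousAffineMap
    (g := (ContinuousAffineMap.id ℝ ℝ).prod (ContinuousAffineMap.const ℝ ℝ y)) hF
    ((uniqueDiffOn_Icc hab).prod (uniqueDiffOn_Icc hcd)) hB (uniqueDiffOn_Icc hab)
    (ContinuousLinearMap.norm_inl_le_one ℝ ℝ ℝ) fun _ hx => ⟨hx, hy⟩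

theorem hasBoundedDerivs_slice_snd {F : ℝ × ℝ → ℝ} (hab : a < b) (hcd : c < d)
    (hF : ContDiffOn ℝ n F (Icc a b ×ˢ Icc c d))
    (hB : ∀ z ∈ Icc a b ×ˢ Icc c d, ∀ m ≤ n,
      ‖iteratedFDerivWithin ℝ m F (Icc a b ×ˢ Icc c d) z‖ ≤ B) {x : ℝ} (hx : x ∈ Icc a b) :
    HasBoundedDerivs n B (fun y => F (x, y)) (Icc c d) :=
  hasBoundedDerivs_comp_continuousAffineMap
    (g := (ContinuousAffineMap.const ℝ ℝ x).prod (ContinuousAffineMap.id ℝ ℝ)) hF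
    ((uniqueDiffOn_Icc hab).prod (uniqueDiffOn_Icc hcd)) hB (uniqueDiffOn_Icc hcd)
    (ContinuousLinearMap.norm_inr_le_one ℝ ℝ ℝ) fun _ hy => ⟨hx, hy⟩

theorem IsSmooth.exists_isSeparatelySmooth (hab : a < b) (hcd : c < d)
    {u : ℝ → ℝ → ℝ → ℝ} (hu : IsSmooth a b c d T u) : ∃ B, IsSeparatelySmooth a b c d T B u := by
  obtain ⟨Bs, hBs⟩ := hu.space_bound
  obtain ⟨Bt, hBt⟩ := hu.time_bound
  have hC4 (t) (ht : t ∈ Icc 0 T) := (hu.space t ht).of_le (show ((4 : ℕ) : WithTop ℕ∞) ≤ 6 by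
    norm_num)
  have hB4 (t) (ht : t ∈ Icc 0 T) (z) (hz : z ∈ Icc a b ×ˢ Icc c d) (m : ℕ) (hm : m ≤ 4) :=
    (hBs t ht z hz m (by omega)).trans (le_max_left Bs Bt)
  exact ⟨max Bs Bt, fun t ht => (hu.space t ht).continuousOn,
    fun t ht _ => hasBoundedDerivs_slice_fst hab hcd (hC4 t ht) (hB4 t ht),
    fun t ht _ => hasBoundedDerivs_slice_snd hab hcd (hC4 t ht) (hB4 t ht),
    fun x hx y hy => ⟨hu.time x hx y hy,
      fun m hm t ht => (hBt x hx y hy t ht m hm).trans (le_max_right Bs Bt)⟩⟩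

end Slices

/-! ### Convergence -/

section Convergence

variable {γ a b c d T B τ t : ℝ} {Mx My N : ℕ} {f g u : ℝ → ℝ → ℝ → ℝ} {u₀ : ℝ → ℝ → ℝ}

/-- The constant in the bound of the truncation error by `τ ^ 2 + hx ^ (4 - γ) + hy ^ (4 - γ)`. -/
noncomputable def truncationConst (γ a b c d B : ℝ) : ℝ :=
  B * (1 + 10 * constCd γ a b c d) + interpConst γ a b * B * (d - c)
    + interpConst γ c d * (3 * B) * (b - a)

theorem truncationConst_nonneg (hγ₁ : γ < 1) (hab : a < b) (hcd : c < d) (hB : 0 ≤ B) :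
    0 ≤ truncationConst γ a b c d B := by
  have hC := constCd_pos hγ₁ hab hcd
  have hx := interpConst_nonneg hγ₁.le hab.le
  have hy := interpConst_nonneg hγ₁.le hcd.le
  have hba : 0 < b - a := sub_pos.2 hab
  have hdc : 0 < d - c := sub_pos.2 hcd
  unfold truncationConst
  positivity

theorem IsExactSolution.norm_truncationError_le_truncationConst (hγ₀ : 0 ≤ γ) (hγ₁ : γ < 1)
    (hu : IsExactSolution γ a b c d T f g u₀ u) (hreg : IsSeparatelySmooth a b c d T B u)
    (hB : 0 ≤ B) (hhx : 0 < meshSize a b Mx) (hhy : 0 < meshSize c d My) (ht : 0 ≤ t)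
    (hτ : 0 < τ) (htτ : t + τ ≤ T) :
    ‖truncationError γ a b c d f g u Mx My τ t‖ ≤ τ * (truncationConst γ a b c d B
      * (τ ^ 2 + meshSize a b Mx ^ (4 - γ) + meshSize c d My ^ (4 - γ))) := by
  have hab := (meshSize_pos_iff.1 hhx).1
  have hcd := (meshSize_pos_iff.1 hhy).1
  refine (hu.norm_truncationError_le hγ₀ hγ₁ hreg hhx hhy ht hτ htτ).trans
    (mul_le_mul_of_nonneg_left ?_ hτ.le)
  have hC := constCd_pos hγ₁ hab hcd
  have hκt : 0 ≤ B * (1 + 10 * constCd γ a b c d) := by positivity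
  have hκx : 0 ≤ interpConst γ a b * B * (d - c) :=
    mul_nonneg (mul_nonneg (interpConst_nonneg hγ₁.le hab.le) hB) (sub_nonneg.2 hcd.le)
  have hκy : 0 ≤ interpConst γ c d * (3 * B) * (b - a) :=
    mul_nonneg (mul_nonneg (interpConst_nonneg hγ₁.le hcd.le) (by positivity))
      (sub_nonneg.2 hab.le)
  have hX : 0 ≤ meshSize a b Mx ^ (4 - γ) := by positivity
  have hY : 0 ≤ meshSize c d My ^ (4 - γ) := by positivity
  unfold truncationConst
  nlinarith [mul_nonneg hκt hX, mul_nonneg hκt hY, mul_nonneg hκx (sq_nonneg τ),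
    mul_nonneg hκx hY, mul_nonneg hκy (sq_nonneg τ), mul_nonneg hκy hX]

theorem IsSchemeSolution.norm_nodalError_le_of_isExactSolution (hγ₀ : 0 ≤ γ) (hγ₁ : γ < 1)
    (hhx : 0 < meshSize a b Mx) (hhy : 0 < meshSize c d My) (hτ : 0 < τ)
    (hτC : τ * (10 * constCd γ a b c d) ≤ 1) (hNT : N * τ ≤ T)
    (hu : IsExactSolution γ a b c d T f g u₀ u) (hreg : IsSeparatelySmooth a b c d T B u)
    {U : Fin (N + 1) → Index Mx My → ℝ} (hU : IsSchemeSolution γ a b c d f g u₀ Mx My N τ U)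
    (k : Fin (N + 1)) :
    ‖nodalError a b c d u τ U k‖
      ≤ Real.exp (2 * (10 * constCd γ a b c d) * T) * (2 * truncationConst γ a b c d B * T)
        * (τ ^ 2 + meshSize a b Mx ^ (4 - γ) + meshSize c d My ^ (4 - γ)) := by
  have hab := (meshSize_pos_iff.1 hhx).1
  have hcd := (meshSize_pos_iff.1 hhy).1
  have htime {m : ℕ} (hm : m ≤ N) : m * τ ≤ T := by
    refine le_trans ?_ hNT
    gcongr
  have hT : 0 ≤ T := by simpa using htime (Nat.zero_le N)
  have hB : 0 ≤ B :=
    (hreg.time a (left_mem_Icc.2 hab.le) c (left_mem_Icc.2 hcd.le)).nonneg (left_mem_Icc.2 hT)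
  have hC := constCd_pos hγ₁ hab hcd
  have hκ := truncationConst_nonneg hγ₁ hab hcd hB
  have hkT : k * τ ≤ T := htime k.is_le
  refine (hU.norm_nodalError_le hγ₀ hγ₁ hhx hhy hτ.le hτC (by positivity) hu.initial
    (fun m => hu.norm_truncationError_le_truncationConst hγ₀ hγ₁ hreg hB hhx hhy (by positivity)
      hτ ?_) k).trans ?_
  · simpa [add_mul] using htime m.2
  · calc Real.exp (2 * (10 * constCd γ a b c d) * (k * τ)) * (2 * (truncationConst γ a b c d B
          * (τ ^ 2 + meshSize a b Mx ^ (4 - γ) + meshSize c d My ^ (4 - γ))) * (k * τ))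
      _ ≤ Real.exp (2 * (10 * constCd γ a b c d) * T) * (2 * (truncationConst γ a b c d B
          * (τ ^ 2 + meshSize a b Mx ^ (4 - γ) + meshSize c d My ^ (4 - γ))) * T) := by gcongr
      _ = _ := by ring

end Convergence

end Nonlocal2D

open Nonlocal2D in
theorem theorem3p14_general {γ a b c d : ℝ} (hγ₀ : 0 ≤ γ) (hγ₁ : γ < 1) (hab : a < b)
    (hcd : c < d) (T B : ℝ) :
    ∃ C : ℝ, ∀ (f g : ℝ → ℝ → ℝ → ℝ) (u₀ : ℝ → ℝ → ℝ) (u : ℝ → ℝ → ℝ → ℝ),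
      IsExactSolution γ a b c d T f g u₀ u → IsSeparatelySmooth a b c d T B u →
      ∀ (Mx My N : ℕ) (τ : ℝ), 1 ≤ Mx → 1 ≤ My → 0 < τ →
        τ < 1 / (10 * constCd γ a b c d) → N * τ ≤ T →
        (∃! U : Fin (N + 1) → Index Mx My → ℝ, IsSchemeSolution γ a b c d f g u₀ Mx My N τ U) ∧
        ∀ U : Fin (N + 1) → Index Mx My → ℝ, IsSchemeSolution γ a b c d f g u₀ Mx My N τ U →
          ∀ (k : Fin (N + 1)) (p : Index Mx My),
            |u (node a b Mx (p.1 + 1)) (node c d My (p.2 + 1)) (k * τ) - U k p|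
              ≤ C * (τ ^ 2 + meshSize a b Mx ^ (4 - γ) + meshSize c d My ^ (4 - γ)) := by
  refine ⟨Real.exp (2 * (10 * constCd γ a b c d) * T) * (2 * truncationConst γ a b c d B * T),
    fun f g u₀ u hu hreg Mx My N τ hMx hMy hτ hττ₀ hNT => ?_⟩
  have hhx := meshSize_pos_iff.2 ⟨hab, hMx⟩
  have hhy := meshSize_pos_iff.2 ⟨hcd, hMy⟩
  have hC := constCd_pos hγ₁ hab hcd
  have hτC : τ * (10 * constCd γ a b c d) ≤ 1 := ((lt_div_iff₀ (by positivity)).1 hττ₀).le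
  refine ⟨existsUnique_isSchemeSolution hγ₀ hγ₁ hhx hhy f g u₀ N hτ.le hτC, fun U hU k p => ?_⟩
  exact (norm_le_pi_norm (nodalError a b c d u τ U k) p).trans
    (hU.norm_nodalError_le_of_isExactSolution hγ₀ hγ₁ hhx hhy hτ hτC hNT hu hreg k)

theorem theorem3p14 (γ a b c d T : ℝ) (hγ0 : 0 < γ) (hγ1 : γ < 1) (hab : a < b) (hcd : c < d)
    (hT : 0 < T) (f g : ℝ → ℝ → ℝ → ℝ) (u₀ : ℝ → ℝ → ℝ) (u : ℝ → ℝ → ℝ → ℝ)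
    (hu : Nonlocal2D.IsExactSolution γ a b c d T f g u₀ u)
    (hsmooth : Nonlocal2D.IsSmooth a b c d T u) :
    ∃ C : ℝ, ∀ (Mx My N : ℕ) (τ : ℝ), 1 ≤ Mx → 1 ≤ My → 0 < τ →
      τ < 1 / (10 * Nonlocal2D.constCd γ a b c d) → N * τ ≤ T →
      (∃! U : Fin (N + 1) → Nonlocal2D.Index Mx My → ℝ,
        Nonlocal2D.IsSchemeSolution γ a b c d f g u₀ Mx My N τ U) ∧
      ∀ U : Fin (N + 1) → Nonlocal2D.Index Mx My → ℝ,
        Nonlocal2D.IsSchemeSolution γ a b c d f g u₀ Mx My N τ U →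
        ∀ (k : Fin (N + 1)) (p : Nonlocal2D.Index Mx My),
          |u (Nonlocal2D.node a b Mx (p.1 + 1)) (Nonlocal2D.node c d My (p.2 + 1)) (k * τ)
              - U k p|
            ≤ C * (τ ^ 2 + Nonlocal2D.meshSize a b Mx ^ (4 - γ)
                + Nonlocal2D.meshSize c d My ^ (4 - γ)) := by
  obtain ⟨B, hreg⟩ := hsmooth.exists_isSeparatelySmooth hab hcd
  obtain ⟨C, hC⟩ := theorem3p14_general hγ0.le hγ1 hab hcd T B
  exact ⟨C, hC f g u₀ u hu hreg⟩
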